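/- **Setting.** Consider an episodic MDP with horizon $H$, measurable state space $\mathcal X$ and action space $\mathcal A$, random initial state $\boldsymbol x_1\sim P_0$, deterministic transitions $x_{h+1}=f_h(x_h,a_h)$, and random rewards $\boldsymbol r_h\in[0,1]$ whose law depends on $(x_h,a_h)$. Let $\Pi$ be the set of all (measurable) deterministic policies $\pi=(\pi_h:\mathcal X\to\mathcal A)_h$, $V_1^\pi(x)=\mathbb E^\pi[\sum_{h=1}^H\boldsymbol r_h\mid \boldsymbol x_1=x]$, let $\phi_h:\mathcal X\times\mathcal A\to\mathbb R^d$ ($h\in[H]$) be (measurable) feature maps and let $\phi_h^\pi(x)$ be the value of $\phi_h(\boldsymbol x_h,\boldsymbol a_h)$ on the trajectory of $\pi$ from $\boldsymbol x_1=x$. Assume: * $\|\phi_h(x,a)\|\le1$, and for each $h\in[H]$ there is $w_h^\star$ with $\|w^\star_h\|\le\sqrt d$ and $\mathbb E[\boldsymbol r_h\mid \boldsymbol x_h=x,\boldsymbol a_h=a]=\langle w_h^\star,\phi_h(x,a)\rangle$ for all $x,a$; * linear Bellman completeness: with $\mathcal B_h=\{\theta:|\langle\phi_h(x,a),\theta\rangle|\le1\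 \forall x,a\}$, for each $h<H$ there is $\mathcal T_h:\mathcal B_{h+1}\to\mathcal B_h$ with $\langle\phi_h(x,a),\mathcal T_h\theta\rangle=\max_{a'}\langle\phi_{h+1}(f_h(x,a),a'),\theta\rangle$ for all $\theta\in\mathcal B_{h+1}$ and all $x,a$; * an oracle returns, for all $h,x,\theta$, an element of $\arg\max_a\langle\phi_h(x,a),\theta\rangle$, with fixed (measurable in $x$) tie-breaking. **Algorithm** $\mathrm{PolicyOpt}_{\mathrm{fqi}}(\Psi_{1:H},\Gamma_{1:H},n,\lambda)$, for finite sets $\Psi_\ell,\Gamma_\ell\subset\Pi$, $n\ge1$, $\lambda>0$. (I) For each $\ell\in[H]$ collect in $\mathcal D_\ell$ the triples $(x_\ell,a_\ell,r_\ell)$ of $n$ independent rollouts of each $\pi\in\Gamma_\ell$, and set $\hat w_\ell=\bigl(\lambda I+\sum_{\mathcal D_\ell}\phi_\ell\phi_\ell^\top\bigr)^{-1}\sum_{\mathcal D_\ell}\phi_\ell\, r_\ell$ and $\hat r_\ell=\langle\phi_\ell,\hat w_\ell\rangle$. (II) Fitted Q-iteration with rewards $\hat r$: $\hat Q_H=\hat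 r_H$. For $\ell=H-1,\dots,1$, roll out each $\pi\in\Psi_\ell$ from $n$ initial states $\boldsymbol x_1^{(\pi,m)}$, $m\in[n]$, put $y=\hat r_\ell(x_\ell,a_\ell)+\max_a\hat Q_{\ell+1}(x_{\ell+1},a)$ on each rollout, and set $\hat Q_\ell=\langle\phi_\ell,\hat\theta_\ell\rangle$ with $\hat\theta_\ell=(\sum\phi_\ell\phi_\ell^\top)^\dagger\sum\phi_\ell\,y$ (Moore–Penrose inverse; sums over the $n|\Psi_\ell|$ rollouts). Output $\hat\pi_\ell(x)\in\arg\max_a\hat Q_\ell(x,a)$, computed by the oracle. The data of (I), and of the different layers in (II), are independent. Within a layer of (II) we allow either of two ways to draw the initial states, one being fixed throughout: *fresh*, where all $\boldsymbol x_1^{(\pi,m)}$ are i.i.d. from $P_0$; or *common*, where $\boldsymbol x_1^{(\pi,m)}=\boldsymbol x_1^{(m)}$ for all $\pi$, with $\boldsymbol x_1^{(1)},\dots,\boldsymbol x_1^{(n)}$ i.i.d. from $P_0$. **Lemma (Guarantee of $\mathrm{PolicyOpt}_{\mathrm{fqi}}$).** Let $\delta\in(0,1)$, $\varepsilon_{\mathrm{span}}>0$,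 $\varepsilon_{\mathrm{conc}}\ge0$, let $\mathcal S_1,\dots,\mathcal S_H$ be subspaces of $\mathbb R^d$, and let $\mathcal X^{(H)}=\bigcap_{\ell\in[H-1]}\{x:\operatorname{Span}\{\phi_\ell^\pi(x):\pi\in\Pi\}\subseteq\mathcal S_\ell\}$. Suppose that 1. for every $\ell\in[H]$, with the initial states of layer $\ell$ drawn as in (II), $\mathbb P\bigl[\mathcal S_\ell\subseteq\operatorname{Span}\{\phi^\pi_\ell(\boldsymbol x_1^{(\pi,m)}):m\in[n],\pi\in\Psi_\ell\}\bigr]\ge1-\delta/H^2$; 2. for every $\ell\in[H]$ and $\rho\in\Pi$ there is $\beta_\ell:\Gamma_\ell\to[-2,2]$ with $\bigl\|\mathbb E^\rho[\phi_\ell(\boldsymbol x_\ell,\boldsymbol a_\ell)]-\sum_{\pi\in\Gamma_\ell}\beta_\ell(\pi)\,\mathbb E^\pi[\phi_\ell(\boldsymbol x_\ell,\boldsymbol a_\ell)]\bigr\|\le\varepsilon_{\mathrm{span}}$; 3. $|\Psi_\ell|\le d$ and $|\Gamma_\ell|\le d$ for all $\ell\in[H]$; 4. $\mathbb P[\boldsymbol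 x_1\in\mathcal X^{(H)}]\ge1-\varepsilon_{\mathrm{conc}}$. Then, with probability at least $1-3\delta$, the output $\hat\pi$ satisfies, for every $\pi\in\Pi$, $$\mathbb E\bigl[V_1^\pi(\boldsymbol x_1)-V_1^{\hat\pi}(\boldsymbol x_1)\bigr]\le\sum_{\ell=1}^H\Bigl(2\sqrt{\tfrac dn}\,\zeta(\delta)+2d\,\varepsilon_{\mathrm{stat}}+(\sqrt d+C)\,\varepsilon_{\mathrm{span}}\Bigr)+H\,C\,\varepsilon_{\mathrm{conc}},$$ where the expectation is over a new initial state $\boldsymbol x_1\sim P_0$, $\zeta(\delta)=\sqrt{\lambda d}+\sqrt{2\log(H/\delta)+d\log(1+n/\lambda)}$, $C=\sqrt d+\lambda^{-1/2}\zeta(\delta)$ and $\varepsilon_{\mathrm{stat}}=C\sqrt{8\bigl(d\log(1+2nC)+\log(2Hd/\delta)\bigr)/n}+2/n$. -/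

import Mathlib

open MeasureTheory ProbabilityTheory Set Matrix
open scoped RealInnerProductSpace

namespace LinBC

/-- The feature space `ℝ^d` with its Euclidean norm. -/
abbrev Feat (d : ℕ) : Type := EuclideanSpace ℝ (Fin d)

/-- The event `E` has probability at least `p`. For a measurable `E` this is `p ≤ μ E`; for an event
whose measurability is not known, it says that `E` contains a measurable event of probability at
least `p` (inner probability). -/
def ProbAtLeast {Ω : Type*} [MeasurableSpace Ω] (μ : Measure Ω) (p : ℝ) (E : Set Ω) : Prop :=
  ∃ G : Set Ω, MeasurableSet G ∧ G ⊆ E ∧ p ≤ μ.real G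

/-! ### Decision processes with deterministic transitions -/

/-- A Markov decision process with deterministic transitions, random initial state and random
rewards in `[0,1]`. Layers are numbered from `0`; with horizon `H` the layers are `0, …, H - 1` and
entries with an index `≥ H` play no role. In state `x`, action `a` of layer `h` the reward has the
law `reward h (x, a)` and the next state is `next h x a` (the transition law is the point mass
there). -/
structure DetMDP (X A : Type*) [MeasurableSpace X] [MeasurableSpace A] where
  init : Measure X
  init_prob : IsProbabilityMeasure init
  next : ℕ → X → A → X
  next_meas : ∀ h, Measurable (Function.uncurry (next h))
  reward : ℕ → Kernel (X × A) ℝ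
  reward_markov : ∀ h, IsMarkovKernel (reward h)
  reward_mem : ∀ h x a, ∀ᵐ r ∂(reward h (x, a)), r ∈ Icc (0 : ℝ) 1

attribute [instance] DetMDP.init_prob DetMDP.reward_markov

/-- A deterministic (measurable) policy. -/
structure Policy (X A : Type*) [MeasurableSpace X] [MeasurableSpace A] where
  act : ℕ → X → A
  act_meas : ∀ h, Measurable (act h)

section Model

variable {X A : Type*} [MeasurableSpace X] [MeasurableSpace A] {d : ℕ}

/-- The state reached in layer `h` when `π` is executed from the initial state `x`. -/
def DetMDP.state (M : DetMDP X A) (π : Policy X A) (x : X) : ℕ → X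
  | 0 => x
  | h + 1 => M.next h (M.state π x h) (π.act h (M.state π x h))

/-- The action taken in layer `h` when `π` is executed from the initial state `x`. -/
def DetMDP.action (M : DetMDP X A) (π : Policy X A) (x : X) (h : ℕ) : A :=
  π.act h (M.state π x h)

theorem DetMDP.measurable_state (M : DetMDP X A) (π : Policy X A) (h : ℕ) :
    Measurable (fun x => M.state π x h) := by
  induction h with
  | zero => exact measurable_id
  | succ h ih => exact (M.next_meas h).comp (ih.prodMk ((π.act_meas h).comp ih))

theorem DetMDP.measurable_state_action (M : DetMDP X A) (π : Policy X A) (h : ℕ) :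
    Measurable (fun x => (M.state π x h, M.action π x h)) :=
  (M.measurable_state π h).prodMk ((π.act_meas h).comp (M.measurable_state π h))

/-- The expected reward `𝔼[r_h ∣ x_h = x, a_h = a]`. -/
noncomputable def DetMDP.meanReward (M : DetMDP X A) (h : ℕ) (x : X) (a : A) : ℝ :=
  ∫ r, r ∂(M.reward h (x, a))

/-- The value `V_1^π(x) = 𝔼^π[∑_h r_h ∣ x_1 = x]` with horizon `H`; the states and actions along
the way are determined by `x` and `π`. -/
noncomputable def DetMDP.value (M : DetMDP X A) (H : ℕ) (π : Policy X A) (x : X) : ℝ :=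
  ∑ h ∈ Finset.range H, M.meanReward h (M.state π x h) (M.action π x h)

/-- The feature `φ_h^π(x) = φ_h(x_h, a_h)` along the trajectory of `π` from `x`. -/
def DetMDP.feature (M : DetMDP X A) (φ : ℕ → X → A → Feat d) (π : Policy X A) (h : ℕ) (x : X) :
    Feat d :=
  φ h (M.state π x h) (M.action π x h)

/-- The expected feature `𝔼^π[φ_h(x_h, a_h)]`. -/
noncomputable def DetMDP.meanFeature (M : DetMDP X A) (φ : ℕ → X → A → Feat d) (π : Policy X A)
    (h : ℕ) : Feat d :=
  ∫ x, M.feature φ π h x ∂M.init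

/-- The joint law, for a rollout of `π`, of the initial state and of the reward received in
layer `h`. The states and actions of the rollout are functions of its initial state. -/
noncomputable def DetMDP.rolloutLaw (M : DetMDP X A) (π : Policy X A) (h : ℕ) : Measure (X × ℝ) :=
  M.init ⊗ₘ ((M.reward h).comap (fun x => (M.state π x h, M.action π x h))
    (M.measurable_state_action π h))

/-! ### Assumptions -/

/-- Boundedness of the (measurable) features and linearity of the expected rewards. -/
structure FeatureAssumption (M : DetMDP X A) (H : ℕ) (φ : ℕ → X → A → Feat d) : Prop where
  meas : ∀ h < H, Measurable (Function.uncurry (φ h))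
  norm_le : ∀ h < H, ∀ x a, ‖φ h x a‖ ≤ 1
  reward_linear : ∀ h < H, ∃ w : Feat d, ‖w‖ ≤ √(d : ℝ) ∧ ∀ x a, M.meanReward h x a = ⟪w, φ h x a⟫

/-- The set `𝓑_h` of parameters whose linear function is bounded by `1`. -/
def boundedParams (φ : ℕ → X → A → Feat d) (h : ℕ) : Set (Feat d) :=
  {θ | ∀ x a, |⟪φ h x a, θ⟫| ≤ 1}

/-- Linear Bellman completeness. As the next state is determined by `(x, a)`, the conditional
expectation of `max_{a'} ⟪φ_{h+1}(x_{h+1}, a'), θ⟫` is its value at the next state. In the last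
layer there is no next feature map and hence no condition. -/
def LinearBellmanComplete (M : DetMDP X A) (H : ℕ) (φ : ℕ → X → A → Feat d) : Prop :=
  ∀ h, h + 1 < H → ∃ T : Feat d → Feat d, ∀ θ ∈ boundedParams φ (h + 1),
    T θ ∈ boundedParams φ h ∧
      ∀ x a, ⟪φ h x a, T θ⟫ = ⨆ a' : A, ⟪φ (h + 1) (M.next h x a) a', θ⟫

/-- An action oracle: for every layer, state and parameter it returns a maximizing action of the
linear function, ties being broken in a fixed (measurable) way. -/
structure ArgmaxOracle (H : ℕ) (φ : ℕ → X → A → Feat d) where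
  pick : ℕ → Feat d → X → A
  pick_meas : ∀ h θ, Measurable (pick h θ)
  pick_max : ∀ h < H, ∀ θ x a, ⟪φ h x a, θ⟫ ≤ ⟪φ h x (pick h θ x), θ⟫

/-- The greedy policy of the linear functions `(x, a) ↦ ⟪φ_h(x, a), θ_h⟫`. -/
def ArgmaxOracle.greedy {H : ℕ} {φ : ℕ → X → A → Feat d} (o : ArgmaxOracle H φ) (θ : ℕ → Feat d) :
    Policy X A where
  act h := o.pick h (θ h)
  act_meas h := o.pick_meas h (θ h)

/-- The set of initial states all of whose trajectories have their features in `S_h`, for every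
layer `h` but the last. -/
def coveredStates (M : DetMDP X A) (H : ℕ) (φ : ℕ → X → A → Feat d)
    (S : ℕ → Submodule ℝ (Feat d)) : Set X :=
  {x | ∀ h, h + 1 < H →
    Submodule.span ℝ (range fun π : Policy X A => M.feature φ π h x) ≤ S h}

/-! ### Regression -/

/-- The Moore–Penrose inverse of a real symmetric matrix: `t ↦ t⁻¹` (with `0⁻¹ = 0`) applied to its
eigenvalues. -/
noncomputable def pinv (B : Matrix (Fin d) (Fin d) ℝ) : Matrix (Fin d) (Fin d) ℝ :=
  cfc (fun t : ℝ => t⁻¹) B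

/-- The four Penrose equations. -/
theorem pinv_penrose (B : Matrix (Fin d) (Fin d) ℝ) (hB : B.IsHermitian) :
    B * pinv B * B = B ∧ pinv B * B * pinv B = pinv B ∧
      (B * pinv B).IsHermitian ∧ (pinv B * B).IsHermitian := by
  have hsa : IsSelfAdjoint B := hB
  have hc : ∀ f : ℝ → ℝ, ContinuousOn f (spectrum ℝ B) := fun f =>
    (Matrix.finite_real_spectrum (A := B)).continuousOn f
  have h1 : B * pinv B = cfc (fun t : ℝ => t * t⁻¹) B := by
    rw [cfc_mul (fun t : ℝ => t) (fun t : ℝ => t⁻¹) B (hc _) (hc _), cfc_id' ℝ B, pinv]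
  have h2 : pinv B * B = cfc (fun t : ℝ => t⁻¹ * t) B := by
    rw [cfc_mul (fun t : ℝ => t⁻¹) (fun t : ℝ => t) B (hc _) (hc _), cfc_id' ℝ B, pinv]
  refine ⟨?_, ?_, ?_, ?_⟩
  · rw [h1]
    nth_rewrite 2 [← cfc_id' ℝ B]
    rw [← cfc_mul _ _ B (hc _) (hc _)]
    have h3 : (fun t : ℝ => t * t⁻¹ * t) = fun t : ℝ => t := by
      funext t
      by_cases ht : t = 0 <;> simp [ht]
    rw [h3, cfc_id' ℝ B]
  · rw [h2, pinv, ← cfc_mul _ _ B (hc _) (hc _)]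
    congr 1
    funext t
    by_cases ht : t = 0 <;> simp [ht]
  · rw [h1]; exact cfc_predicate (R := ℝ) _ B
  · rw [h2]; exact cfc_predicate (R := ℝ) _ B

/-- The empirical second-moment matrix `∑_i v_i v_iᵀ`. -/
noncomputable def gram {ι : Type*} [Fintype ι] (v : ι → Feat d) : Matrix (Fin d) (Fin d) ℝ :=
  ∑ i, vecMulVec (v i).ofLp (v i).ofLp

/-- Ridge regression: `(lam I + ∑_i v_i v_iᵀ)⁻¹ ∑_i y_i v_i`. -/
noncomputable def ridge {ι : Type*} [Fintype ι] (lam : ℝ) (v : ι → Feat d) (y : ι → ℝ) : Feat d :=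
  WithLp.toLp 2 ((lam • (1 : Matrix (Fin d) (Fin d) ℝ) + gram v)⁻¹ *ᵥ (∑ i, y i • v i).ofLp)

/-- Minimum-norm least squares: `(∑_i v_i v_iᵀ)† ∑_i y_i v_i`. -/
noncomputable def minNormLS {ι : Type*} [Fintype ι] (v : ι → Feat d) (y : ι → ℝ) : Feat d :=
  WithLp.toLp 2 (pinv (gram v) *ᵥ (∑ i, y i • v i).ofLp)

/-! ### The planning step: fitted Q-iteration -/

/-- The data of layer `ℓ` in fitted Q-iteration is given by the initial states of `n` rollouts of
each policy `π ∈ Ψ_ℓ`. -/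
abbrev Starts (X : Type*) {A : Type*} [MeasurableSpace X] [MeasurableSpace A]
    (Q : Finset (Policy X A)) (n : ℕ) : Type _ :=
  (Q × Fin n) → X

/-- How the initial states of the rollouts of one layer of fitted Q-iteration are drawn:
`fresh`: independently for all the rollouts; `common`: `n` i.i.d. initial states are drawn, and the
`m`-th rollout of every policy starts from the `m`-th of them. -/
inductive StartScheme
  | fresh
  | common

/-- The law of the initial states of one layer under each scheme. -/
noncomputable def DetMDP.startLaw (M : DetMDP X A) (s : StartScheme) (Q : Finset (Policy X A))
    (n : ℕ) : Measure (Starts X Q n) :=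
  match s with
  | .fresh => Measure.pi fun _ => M.init
  | .common => (Measure.pi fun _ : Fin n => M.init).map fun y p => y p.2

/-- The parameters `θ̂_ℓ` of fitted Q-iteration with horizon `H`, for the deterministic rewards
`(x, a) ↦ ⟪φ_ℓ(x, a), w_ℓ⟫`: in the last layer `Q̂ = r`, and before it `Q̂_ℓ = ⟪φ_ℓ, θ̂_ℓ⟫` with
`θ̂_ℓ` the minimum-norm least-squares fit to the targets
`r_ℓ(x_ℓ, a_ℓ) + max_a Q̂_{ℓ+1}(x_{ℓ+1}, a)` over the rollouts of the policies in `Ψ_ℓ`. -/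
noncomputable def fqiParam (M : DetMDP X A) (H : ℕ) (φ : ℕ → X → A → Feat d) (w : ℕ → Feat d)
    (Ψ : ℕ → Finset (Policy X A)) (n : ℕ) (x : (ℓ : Fin H) → Starts X (Ψ ℓ) n) (ℓ : ℕ) : Feat d :=
  if h : ℓ + 1 < H then
    minNormLS
      (fun p : Ψ ℓ × Fin n => M.feature φ p.1 ℓ (x ⟨ℓ, by omega⟩ p))
      (fun p : Ψ ℓ × Fin n =>
        ⟪M.feature φ p.1 ℓ (x ⟨ℓ, by omega⟩ p), w ℓ⟫ +
          ⨆ a : A, ⟪φ (ℓ + 1) (M.state p.1 (x ⟨ℓ, by omega⟩ p) (ℓ + 1)) a,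
            fqiParam M H φ w Ψ n x (ℓ + 1)⟫)
  else w ℓ
termination_by H - ℓ

/-! ### The policy-optimization algorithm -/

/-- The samples of one run: for every layer `ℓ`, policy `π ∈ Γ_ℓ` and `m`, the initial state and
the layer-`ℓ` reward of a rollout of `π`; and the initial states used by fitted Q-iteration. -/
abbrev Samples (X : Type*) {A : Type*} [MeasurableSpace X] [MeasurableSpace A] (H : ℕ)
    (Ψ Γ : ℕ → Finset (Policy X A)) (n : ℕ) : Type _ :=
  ((i : (ℓ : Fin H) × (Γ ℓ × Fin n)) → X × ℝ) × ((ℓ : Fin H) → Starts X (Ψ ℓ) n)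

/-- The law of the samples: all rollouts for the reward regression are independent, and
independent of those of fitted Q-iteration, which are independent across layers. -/
noncomputable def DetMDP.sampleLaw (M : DetMDP X A) (s : StartScheme) (H : ℕ)
    (Ψ Γ : ℕ → Finset (Policy X A)) (n : ℕ) : Measure (Samples X H Ψ Γ n) :=
  (Measure.pi fun i : (ℓ : Fin H) × (Γ ℓ × Fin n) => M.rolloutLaw i.2.1 i.1).prod
    (Measure.pi fun ℓ : Fin H => M.startLaw s (Ψ ℓ) n)

/-- The estimated reward parameter `ŵ_ℓ` (for `ℓ < H`): ridge regression of the observed rewards of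
layer `ℓ` on the features. -/
noncomputable def rewardParam (M : DetMDP X A) (H : ℕ) (φ : ℕ → X → A → Feat d)
    {Ψ Γ : ℕ → Finset (Policy X A)} {n : ℕ} (lam : ℝ) (ω : Samples X H Ψ Γ n) (ℓ : ℕ) : Feat d :=
  if h : ℓ < H then
    ridge lam
      (fun p : Γ ℓ × Fin n => M.feature φ p.1 ℓ (ω.1 ⟨⟨ℓ, h⟩, p⟩).1)
      (fun p : Γ ℓ × Fin n => (ω.1 ⟨⟨ℓ, h⟩, p⟩).2)
  else 0

/-- The output policy: the greedy policy of fitted Q-iteration run with the estimated rewards. -/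
noncomputable def policyOpt (M : DetMDP X A) (H : ℕ) (φ : ℕ → X → A → Feat d)
    (o : ArgmaxOracle H φ) {Ψ Γ : ℕ → Finset (Policy X A)} {n : ℕ} (lam : ℝ)
    (ω : Samples X H Ψ Γ n) : Policy X A :=
  o.greedy (fqiParam M H φ (rewardParam M H φ lam ω) Ψ n ω.2)

end Model

/-! ### The constants of the bound -/

noncomputable def zeta (d H n : ℕ) (lam δ : ℝ) : ℝ :=
  √(lam * d) + √(2 * Real.log (H / δ) + d * Real.log (1 + n / lam))

noncomputable def boundC (d H n : ℕ) (lam δ : ℝ) : ℝ :=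
  √(d : ℝ) + (√lam)⁻¹ * zeta d H n lam δ

noncomputable def epsStat (d H n : ℕ) (lam δ : ℝ) : ℝ :=
  boundC d H n lam δ *
      √(8 * (d * Real.log (1 + 2 * n * boundC d H n lam δ) + Real.log (2 * H * d / δ)) / n) +
    2 / n

end LinBC

open LinBC

/-!
The regret of the greedy policy splits into a planning error, for the rewards `r̂ = ⟪w, φ⟫`
estimated by ridge regression, and the error of replacing the true rewards by `r̂`.

*Planning.* The transitions are deterministic, so by linear Bellman completeness (extended to all
parameters by homogeneity) the regression targets of fitted Q-iteration are noiseless linear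
functions of the features. Minimum-norm least squares therefore reproduces them exactly on the span
of the data (`inner_minNormLS_of_mem_span`). If these spans contain the subspaces `S`, the Bellman
equation holds exactly along every trajectory from a covered state, and a telescoping sum shows that
the greedy policy is optimal there for `r̂` (`sum_inner_feature_le_greedy`). From the uncovered
states one pays at most twice the bound on `r̂` in each layer.

*Rewards.* The mean feature of any policy is, up to `εspan`, a combination of those of the policies
in `Γ` with coefficients in `[-2, 2]`. So it suffices to bound the error of the reward parameter on
the mean features of `Γ`; these are compared with the empirical averages, and Cauchy-Schwarz reduces
the empirical error to the in-sample error of ridge regression (`sum_abs_inner_le_of_average`).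

*Concentration.* Both the noise of ridge regression and the deviation of the average features are
controlled by the method of mixtures (`measure_selfNormalized_ge_le`): if
`𝔼 exp (⟪u, S⟫ - ⟪u, V u⟫ / 2) ≤ 1` for all `u`, integrate over a Gaussian `u`. For the averages,
with `V = n I`, this gives a dimension-dependent tail directly for the norm, hence uniformly over
parameters, without a covering argument.

*Constants.* Both the compared policy and the greedy one incur the reward error, each with the factor
`2` of the coefficients. The bound has room for this because all errors of ridge regression are half
of what the standard estimate gives: rewards in `[0, 1]` have sub-Gaussian variance proxy `1/4`
rather than `1`, and the bias of ridge regression is at most `√lam ‖w‖ / 2` in the in-sample seminorm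
(`ridge_error_bounds`). So the in-sample error is at most `zeta / 2`, and both the estimate and its
error have norm at most `boundC / 2`.
-/

namespace LinBC

open scoped ENNReal

/-! ### Gaussian integrals and the method of mixtures -/

section GaussianMixture

variable {d : ℕ}

theorem lintegral_exp_neg_half_sq_norm_ne_zero :
    ∫⁻ u : Feat d, ENNReal.ofReal (Real.exp (-(‖u‖ ^ 2 / 2))) ≠ 0 := by
  rw [Ne, lintegral_eq_zero_iff (by fun_prop)]
  intro h
  have h1 : ∀ᵐ u : Feat d, False := by
    filter_upwards [h] with u hu
    simp only [Pi.zero_apply, ENNReal.ofReal_eq_zero] at hu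
    exact absurd (Real.exp_pos _) (not_lt.mpr hu)
  rw [Filter.eventually_false_iff_eq_bot, ae_eq_bot] at h1
  simpa [h1] using isOpen_univ.measure_pos (volume : Measure (Feat d)) univ_nonempty

theorem lintegral_exp_neg_half_sq_norm_ne_top :
    ∫⁻ u : Feat d, ENNReal.ofReal (Real.exp (-(‖u‖ ^ 2 / 2))) ≠ ∞ := by
  have hi : Integrable (fun u : Feat d => Real.exp (-(‖u‖ ^ 2 / 2))) := by
    -- otherwise the integral, whose value is known and positive, would be zero by convention
    by_contra hni
    have h1 := GaussianFourier.integral_rexp_neg_mul_sq_norm (V := Feat d)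
      (b := 1 / 2) (by norm_num)
    have h2 : ∀ u : Feat d, -(1 / 2 : ℝ) * ‖u‖ ^ 2 = -(‖u‖ ^ 2 / 2) := fun u => by ring
    simp_rw [h2] at h1
    rw [integral_undef hni] at h1
    have : (0 : ℝ) < (Real.pi / (1 / 2)) ^ (Module.finrank ℝ (Feat d) / 2 : ℝ) := by
      have := Real.pi_pos
      positivity
    exact this.ne h1
  exact hi.lintegral_lt_top.ne

open scoped MatrixOrder in
/-- The Gaussian integral of a positive definite quadratic form, relative to that of the standard
one. -/
theorem lintegral_exp_neg_half_quadratic {W : Matrix (Fin d) (Fin d) ℝ} (hW : W.PosDef) :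
    ∫⁻ u : Feat d, ENNReal.ofReal (Real.exp (-(⟪u, W.toEuclideanLin u⟫ / 2))) =
      ENNReal.ofReal (√W.det)⁻¹ *
        ∫⁻ u : Feat d, ENNReal.ofReal (Real.exp (-(‖u‖ ^ 2 / 2))) := by
  -- change of variables by the square root of `W`
  set B := CFC.sqrt W with hB
  have hW0 : 0 ≤ W := Matrix.nonneg_iff_posSemidef.mpr hW.posSemidef
  have hBB : B * B = W := CFC.sqrt_mul_sqrt_self W hW0
  have hBpsd : B.PosSemidef := Matrix.nonneg_iff_posSemidef.mp (CFC.sqrt_nonneg W)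
  have hdet : B.det = √W.det := by
    rw [← hBB, Matrix.det_mul, Real.sqrt_mul_self hBpsd.det_nonneg]
  have hpos : 0 < √W.det := Real.sqrt_pos.mpr hW.det_pos
  have hquad : ∀ u : Feat d, ⟪u, W.toEuclideanLin u⟫ = ‖B.toEuclideanLin u‖ ^ 2 := by
    intro u
    have hsym := (Matrix.isSymmetric_toEuclideanLin_iff).mpr hBpsd.isHermitian
    rw [← real_inner_self_eq_norm_sq, hsym, ← hBB, Matrix.toLpLin_mul_same]
    rfl
  have hdet' : LinearMap.det B.toEuclideanLin = √W.det := by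
    rw [LinearMap.det_toLpLin, hdet]
  have hmap := Measure.map_linearMap_addHaar_eq_smul_addHaar (volume : Measure (Feat d))
    (f := B.toEuclideanLin) (by rw [hdet']; exact hpos.ne')
  have hmeas : Measurable (B.toEuclideanLin : Feat d → Feat d) :=
    (LinearMap.continuous_of_finiteDimensional _).measurable
  simp_rw [hquad]
  rw [← lintegral_map (f := fun v : Feat d => ENNReal.ofReal (Real.exp (-(‖v‖ ^ 2 / 2))))
    (by fun_prop) hmeas, hmap, lintegral_smul_measure, hdet', abs_of_pos (inv_pos.mpr hpos)]
  rfl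

/-- Completing the square: the Gaussian integral with a linear term `⟪u, W y⟫`. -/
theorem lintegral_exp_inner_sub_half_quadratic {W : Matrix (Fin d) (Fin d) ℝ} (hW : W.PosDef)
    (y : Feat d) :
    ∫⁻ u : Feat d, ENNReal.ofReal
        (Real.exp (⟪u, W.toEuclideanLin y⟫ - ⟪u, W.toEuclideanLin u⟫ / 2)) =
      ENNReal.ofReal (Real.exp (⟪y, W.toEuclideanLin y⟫ / 2)) *
        (ENNReal.ofReal (√W.det)⁻¹ *
          ∫⁻ u : Feat d, ENNReal.ofReal (Real.exp (-(‖u‖ ^ 2 / 2)))) := by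
  have hsym := (Matrix.isSymmetric_toEuclideanLin_iff).mpr hW.isHermitian
  have hsq : ∀ u : Feat d, ENNReal.ofReal
      (Real.exp (⟪u, W.toEuclideanLin y⟫ - ⟪u, W.toEuclideanLin u⟫ / 2)) =
      ENNReal.ofReal (Real.exp (⟪y, W.toEuclideanLin y⟫ / 2)) *
        ENNReal.ofReal (Real.exp (-(⟪u - y, W.toEuclideanLin (u - y)⟫ / 2))) := by
    intro u
    rw [← ENNReal.ofReal_mul (Real.exp_nonneg _), ← Real.exp_add]
    congr 2
    have h1 : ⟪y, W.toEuclideanLin u⟫ = ⟪u, W.toEuclideanLin y⟫ := by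
      rw [← hsym, real_inner_comm]
    rw [map_sub, inner_sub_left, inner_sub_right, inner_sub_right, h1]
    ring
  have hc : Continuous (W.toEuclideanLin : Feat d → Feat d) :=
    LinearMap.continuous_of_finiteDimensional _
  simp_rw [hsq]
  rw [lintegral_const_mul _ (by fun_prop),
    lintegral_sub_right_eq_self
      (fun u : Feat d => ENNReal.ofReal (Real.exp (-(⟪u, W.toEuclideanLin u⟫ / 2)))) y,
    lintegral_exp_neg_half_quadratic hW]

theorem toEuclideanLin_ridge_apply (lam : ℝ) (V : Matrix (Fin d) (Fin d) ℝ) (u : Feat d) :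
    (lam • (1 : Matrix (Fin d) (Fin d) ℝ) + V).toEuclideanLin u =
      lam • u + V.toEuclideanLin u := by
  rw [map_add, map_smul, Matrix.toLpLin_one]
  rfl

theorem posDef_ridge {lam : ℝ} (hlam : 0 < lam) {V : Matrix (Fin d) (Fin d) ℝ}
    (hV : V.PosSemidef) : (lam • (1 : Matrix (Fin d) (Fin d) ℝ) + V).PosDef :=
  (Matrix.PosDef.one.smul hlam).add_posSemidef hV

/-- The method of mixtures. If `S` is sub-Gaussian relative to the random quadratic form `V`, then
`⟪y, S⟫ = ‖S‖²` in the norm of `(lam I + V)⁻¹`, where `(lam I + V) y = S`, is at most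
`2 log (1/δ) + log (det (lam I + V) / lam ^ d)` except with probability `δ`. -/
theorem measure_selfNormalized_ge_le {Ω : Type*} [MeasurableSpace Ω] (μ : Measure Ω)
    [IsProbabilityMeasure μ] {S : Ω → Feat d} {V : Ω → Matrix (Fin d) (Fin d) ℝ}
    (hS : Measurable S) (hV : ∀ ω, (V ω).PosSemidef)
    (hVm : Measurable fun p : Feat d × Ω => ⟪p.1, (V p.2).toEuclideanLin p.1⟫)
    (hmgf : ∀ u : Feat d, ∫⁻ ω, ENNReal.ofReal
      (Real.exp (⟪u, S ω⟫ - ⟪u, (V ω).toEuclideanLin u⟫ / 2)) ∂μ ≤ 1)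
    {lam δ : ℝ} (hlam : 0 < lam) (hδ : 0 < δ) :
    μ {ω | ∃ y : Feat d, lam • y + (V ω).toEuclideanLin y = S ω ∧
      2 * Real.log (1 / δ) +
        Real.log ((lam • (1 : Matrix (Fin d) (Fin d) ℝ) + V ω).det / lam ^ d) ≤ ⟪y, S ω⟫} ≤
      ENNReal.ofReal δ := by
  set g0 := ∫⁻ u : Feat d, ENNReal.ofReal (Real.exp (-(‖u‖ ^ 2 / 2))) with hg0
  set c := ENNReal.ofReal (√(lam ^ d))⁻¹ * g0 with hc
  have hlamd : 0 < √(lam ^ d) := Real.sqrt_pos.mpr (pow_pos hlam d)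
  have hc0 : c ≠ 0 := mul_ne_zero (by simpa using hlamd)
    lintegral_exp_neg_half_sq_norm_ne_zero
  have hctop : c ≠ ∞ := ENNReal.mul_ne_top ENNReal.ofReal_ne_top
    lintegral_exp_neg_half_sq_norm_ne_top
  -- the Gaussian weight of variance `1 / lam`
  have hweight : ∫⁻ u : Feat d, ENNReal.ofReal (Real.exp (-(lam * ‖u‖ ^ 2 / 2))) = c := by
    have h := lintegral_exp_neg_half_quadratic
      (posDef_ridge (d := d) hlam (V := 0) Matrix.PosSemidef.zero)
    simp_rw [toEuclideanLin_ridge_apply] at h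
    simpa [inner_smul_right, real_inner_self_eq_norm_sq, Matrix.det_smul, hc, hg0] using h
  let G : Feat d → Ω → ℝ≥0∞ := fun u ω =>
    ENNReal.ofReal (Real.exp (-(lam * ‖u‖ ^ 2 / 2))) *
      ENNReal.ofReal (Real.exp (⟪u, S ω⟫ - ⟪u, (V ω).toEuclideanLin u⟫ / 2))
  have hGm : Measurable (Function.uncurry G) := by
    have h1 : Measurable fun p : Feat d × Ω => ⟪p.1, S p.2⟫ :=
      measurable_fst.inner (hS.comp measurable_snd)
    exact (by fun_prop : Measurable fun p : Feat d × Ω =>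
      ENNReal.ofReal (Real.exp (-(lam * ‖p.1‖ ^ 2 / 2)))).mul
        (Real.measurable_exp.comp (h1.sub (hVm.div_const 2))).ennreal_ofReal
  have hF : ∫⁻ ω, (∫⁻ u, G u ω) ∂μ ≤ c := by
    rw [lintegral_lintegral_swap (f := fun ω u => G u ω)
      (hGm.comp measurable_swap).aemeasurable, ← hweight]
    refine lintegral_mono fun u => ?_
    have hm : Measurable fun ω => ENNReal.ofReal
        (Real.exp (⟪u, S ω⟫ - ⟪u, (V ω).toEuclideanLin u⟫ / 2)) := by
      have h1 : Measurable fun ω => ⟪u, (V ω).toEuclideanLin u⟫ := by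
        obtain ⟨q, hq⟩ : ∃ q : Feat d → Ω → ℝ,
          q = fun u ω => ⟪u, (V ω).toEuclideanLin u⟫ := ⟨_, rfl⟩
        have hqm : Measurable fun p : Feat d × Ω => q p.1 p.2 := by rw [hq]; exact hVm
        have hqu : Measurable fun ω => q u ω := hqm.comp measurable_prodMk_left
        rw [hq] at hqu
        exact hqu
      have h2 : Measurable fun ω => ⟪u, S ω⟫ := measurable_const.inner hS
      exact (Real.measurable_exp.comp (h2.sub (h1.div_const 2))).ennreal_ofReal
    calc ∫⁻ ω, G u ω ∂μ = ENNReal.ofReal (Real.exp (-(lam * ‖u‖ ^ 2 / 2))) * _ :=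
          lintegral_const_mul _ hm
      _ ≤ ENNReal.ofReal (Real.exp (-(lam * ‖u‖ ^ 2 / 2))) * 1 := by gcongr; exact hmgf u
      _ = _ := mul_one _
  have hsub : {ω | ∃ y : Feat d, lam • y + (V ω).toEuclideanLin y = S ω ∧
      2 * Real.log (1 / δ) +
        Real.log ((lam • (1 : Matrix (Fin d) (Fin d) ℝ) + V ω).det / lam ^ d) ≤ ⟪y, S ω⟫} ⊆
      {ω | ENNReal.ofReal (1 / δ) * c ≤ ∫⁻ u, G u ω} := by
    rintro ω ⟨y, hy, hle⟩
    have hW := posDef_ridge hlam (hV ω)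
    set W := lam • (1 : Matrix (Fin d) (Fin d) ℝ) + V ω with hWdef
    have hWy : W.toEuclideanLin y = S ω := by rw [hWdef, toEuclideanLin_ridge_apply, hy]
    have hGW : ∫⁻ u, G u ω = ENNReal.ofReal (Real.exp (⟪y, S ω⟫ / 2)) *
        (ENNReal.ofReal (√W.det)⁻¹ * g0) := by
      rw [← hWy, hg0, ← lintegral_exp_inner_sub_half_quadratic hW y]
      refine lintegral_congr fun u => ?_
      simp only [G]
      rw [← ENNReal.ofReal_mul (Real.exp_nonneg _), ← Real.exp_add, hWy, hWdef,
        toEuclideanLin_ridge_apply, inner_add_right, inner_smul_right,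
        real_inner_self_eq_norm_sq]
      congr 2
      ring
    have hdet : 0 < √W.det := Real.sqrt_pos.mpr hW.det_pos
    have hkey : 1 / δ * (√(lam ^ d))⁻¹ ≤ Real.exp (⟪y, S ω⟫ / 2) * (√W.det)⁻¹ := by
      rw [← div_eq_mul_inv, ← div_eq_mul_inv, div_le_div_iff₀ hlamd hdet]
      have h1 : Real.log (W.det / lam ^ d) / 2 = Real.log (√W.det / √(lam ^ d)) := by
        rw [← Real.sqrt_div' _ (pow_pos hlam d).le, Real.log_sqrt (by
          exact div_nonneg hW.det_pos.le (pow_pos hlam d).le)]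
      have h2 : 1 / δ * (√W.det / √(lam ^ d)) ≤ Real.exp (⟪y, S ω⟫ / 2) := by
        rw [← Real.log_le_iff_le_exp (by positivity), Real.log_mul (by positivity)
          (by positivity), ← h1]
        linarith
      calc 1 / δ * √W.det = 1 / δ * (√W.det / √(lam ^ d)) * √(lam ^ d) := by
            field_simp
        _ ≤ _ := mul_le_mul_of_nonneg_right h2 hlamd.le
    show ENNReal.ofReal (1 / δ) * c ≤ ∫⁻ u, G u ω
    rw [hGW, hc, ← mul_assoc, ← mul_assoc, ← ENNReal.ofReal_mul (by positivity),
      ← ENNReal.ofReal_mul (Real.exp_nonneg _)]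
    gcongr
  have hFm : Measurable fun ω => ∫⁻ u, G u ω :=
    Measurable.lintegral_prod_left' (μ := (volume : Measure (Feat d))) hGm
  have hmarkov := mul_meas_ge_le_lintegral (μ := μ) hFm (ENNReal.ofReal (1 / δ) * c)
  have hfin : ENNReal.ofReal (1 / δ) * c * μ {ω | ENNReal.ofReal (1 / δ) * c ≤ ∫⁻ u, G u ω} ≤ c :=
    hmarkov.trans hF
  refine (measure_mono hsub).trans ?_
  set m := μ {ω | ENNReal.ofReal (1 / δ) * c ≤ ∫⁻ u, G u ω}
  have h3 : c * (ENNReal.ofReal (1 / δ) * m) ≤ c * 1 := by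
    rw [mul_one]; refine le_trans (le_of_eq ?_) hfin; ring
  have h4 := (ENNReal.mul_le_mul_iff_right hc0 hctop).mp h3
  calc m = ENNReal.ofReal δ * (ENNReal.ofReal (1 / δ) * m) := by
        rw [← mul_assoc, ← ENNReal.ofReal_mul hδ.le, mul_one_div_cancel hδ.ne',
          ENNReal.ofReal_one, one_mul]
    _ ≤ ENNReal.ofReal δ * 1 := by gcongr
    _ = _ := mul_one _

end GaussianMixture

/-! ### Least squares and ridge regression -/

section LinearRegression

variable {d : ℕ} {ι : Type*} [Fintype ι]

theorem gram_toEuclideanLin_apply (v : ι → Feat d) (u : Feat d) :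
    (gram v).toEuclideanLin u = ∑ i, ⟪v i, u⟫ • v i := by
  simp only [gram, map_sum, LinearMap.sum_apply]
  refine Finset.sum_congr rfl fun i _ => ?_
  ext j
  simp [Matrix.toLpLin_apply, Matrix.vecMulVec_mulVec, EuclideanSpace.inner_eq_star_dotProduct,
    dotProduct_comm]

theorem inner_gram_toEuclideanLin (v : ι → Feat d) (u w : Feat d) :
    ⟪u, (gram v).toEuclideanLin w⟫ = ∑ i, ⟪v i, u⟫ * ⟪v i, w⟫ := by
  simp_rw [gram_toEuclideanLin_apply, inner_sum, inner_smul_right]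
  refine Finset.sum_congr rfl fun i _ => ?_
  rw [real_inner_comm u (v i), mul_comm]

theorem inner_gram_self (v : ι → Feat d) (u : Feat d) :
    ⟪u, (gram v).toEuclideanLin u⟫ = ∑ i, ⟪v i, u⟫ ^ 2 := by
  simp_rw [inner_gram_toEuclideanLin, pow_two]

theorem gram_posSemidef (v : ι → Feat d) : (gram v).PosSemidef := by
  refine Matrix.posSemidef_sum _ fun i _ => ?_
  simpa using Matrix.posSemidef_vecMulVec_self_star (v i).ofLp

theorem trace_gram (v : ι → Feat d) : (gram v).trace = ∑ i, ‖v i‖ ^ 2 := by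
  simp_rw [gram, Matrix.trace_sum, Matrix.trace_vecMulVec, ← real_inner_self_eq_norm_sq,
    EuclideanSpace.inner_eq_star_dotProduct]
  simp

/-- Fitting noiseless linear targets by minimum-norm least squares recovers the linear function on
the span of the data. -/
theorem inner_minNormLS_of_mem_span (v : ι → Feat d) (y : ι → ℝ) (θ w : Feat d)
    (hy : ∀ i, y i = ⟪v i, θ⟫) (hw : w ∈ Submodule.span ℝ (range v)) :
    ⟪w, minNormLS v y⟫ = ⟪w, θ⟫ := by
  have hfit : minNormLS v y = (pinv (gram v)).toEuclideanLin ((gram v).toEuclideanLin θ) := by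
    rw [gram_toEuclideanLin_apply, minNormLS, Matrix.toLpLin_apply]
    simp_rw [hy]
  have hzero : (gram v).toEuclideanLin (minNormLS v y - θ) = 0 := by
    rw [map_sub, sub_eq_zero, hfit, ← LinearMap.comp_apply, ← LinearMap.comp_apply,
      ← Matrix.toLpLin_mul_same, LinearMap.comp_apply, ← LinearMap.comp_apply,
      ← Matrix.toLpLin_mul_same, (pinv_penrose (gram v) (gram_posSemidef v).isHermitian).1]
  have hsum := inner_gram_self v (minNormLS v y - θ)
  rw [hzero, inner_zero_right, eq_comm,
    Finset.sum_eq_zero_iff_of_nonneg fun i _ => sq_nonneg _] at hsum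
  rw [← sub_eq_zero, ← inner_sub_right]
  induction hw using Submodule.span_induction with
  | mem x hx =>
    obtain ⟨i, rfl⟩ := hx
    exact pow_eq_zero_iff two_ne_zero |>.mp (hsum i (Finset.mem_univ i))
  | zero => exact inner_zero_left _
  | add x z _ _ hx hz => rw [inner_add_left, hx, hz, add_zero]
  | smul c x _ hx => rw [inner_smul_left, hx, mul_zero]

/-- The determinant bound of ridge regression: arithmetic-geometric mean for the eigenvalues. -/
theorem det_ridge_le {lam : ℝ} (hlam : 0 < lam) (v : ι → Feat d) (hv : ∀ i, ‖v i‖ ≤ 1) {N : ℝ}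
    (hN : (Fintype.card ι : ℝ) ≤ d * N) :
    (lam • (1 : Matrix (Fin d) (Fin d) ℝ) + gram v).det ≤ (lam + N) ^ d := by
  rcases Nat.eq_zero_or_pos d with rfl | hd
  · simp
  have hd' : (0 : ℝ) < d := Nat.cast_pos.mpr hd
  have hW := posDef_ridge hlam (gram_posSemidef v)
  set W := lam • (1 : Matrix (Fin d) (Fin d) ℝ) + gram v with hWdef
  have htr : ∑ i, hW.isHermitian.eigenvalues i ≤ d * (lam + N) := by
    have h1 := hW.isHermitian.trace_eq_sum_eigenvalues
    simp only [RCLike.ofReal_real_eq_id, id_eq] at h1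
    rw [← h1, hWdef, Matrix.trace_add, Matrix.trace_smul, Matrix.trace_one, trace_gram]
    have h2 : ∑ i, ‖v i‖ ^ 2 ≤ Fintype.card ι := by
      have := Finset.sum_le_card_nsmul Finset.univ (fun i => ‖v i‖ ^ 2) 1
        fun i _ => pow_le_one₀ (norm_nonneg _) (hv i)
      simpa using this
    simp only [Fintype.card_fin, smul_eq_mul]
    linarith
  have hnn : ∀ i, 0 ≤ hW.isHermitian.eigenvalues i := fun i => (hW.eigenvalues_pos i).le
  have ham := Real.geom_mean_le_arith_mean Finset.univ (fun _ : Fin d => (1 : ℝ))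
    hW.isHermitian.eigenvalues (fun _ _ => zero_le_one) (by simpa using hd) fun i _ => hnn i
  simp only [Real.rpow_one, Finset.sum_const, Finset.card_univ, Fintype.card_fin, nsmul_eq_mul,
    mul_one, one_mul] at ham
  have hprod : W.det = ∏ i, hW.isHermitian.eigenvalues i := by
    simpa using hW.isHermitian.det_eq_prod_eigenvalues
  have hpn : 0 ≤ ∏ i, hW.isHermitian.eigenvalues i := Finset.prod_nonneg fun i _ => hnn i
  rw [hprod]
  calc ∏ i, hW.isHermitian.eigenvalues i
      = ((∏ i, hW.isHermitian.eigenvalues i) ^ ((d : ℝ)⁻¹)) ^ d :=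
        (Real.rpow_inv_natCast_pow hpn hd.ne').symm
    _ ≤ (lam + N) ^ d := by
        refine pow_le_pow_left₀ (Real.rpow_nonneg hpn _) (ham.trans ?_) d
        rw [div_le_iff₀ hd']
        linarith

/-- Ridge regression solves its normal equations. -/
theorem ridge_normal_equation {lam : ℝ} (hlam : 0 < lam) (v : ι → Feat d) (y : ι → ℝ) :
    lam • ridge lam v y + (gram v).toEuclideanLin (ridge lam v y) = ∑ i, y i • v i := by
  have hW := posDef_ridge hlam (gram_posSemidef v)
  rw [← toEuclideanLin_ridge_apply, ridge, Matrix.toLpLin_toLp, Matrix.toLin'_apply,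
    Matrix.mulVec_mulVec, Matrix.mul_nonsing_inv _ (isUnit_iff_ne_zero.mpr hW.det_pos.ne'),
    Matrix.one_mulVec]

theorem exists_ridge_solution {lam : ℝ} (hlam : 0 < lam) (v : ι → Feat d) (b : Feat d) :
    ∃ z : Feat d, lam • z + (gram v).toEuclideanLin z = b := by
  have hW := posDef_ridge hlam (gram_posSemidef v)
  refine ⟨WithLp.toLp 2 ((lam • (1 : Matrix (Fin d) (Fin d) ℝ) + gram v)⁻¹ *ᵥ b.ofLp), ?_⟩
  rw [← toEuclideanLin_ridge_apply, Matrix.toLpLin_toLp, Matrix.toLin'_apply,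
    Matrix.mulVec_mulVec, Matrix.mul_nonsing_inv _ (isUnit_iff_ne_zero.mpr hW.det_pos.ne'),
    Matrix.one_mulVec]

/-- The seminorm `√(∑ i, ⟪v i, u⟫²)` of `u` satisfies the triangle inequality. -/
theorem sqrt_sum_inner_sq_sub_le (v : ι → Feat d) (a b : Feat d) :
    √(∑ i, ⟪v i, a - b⟫ ^ 2) ≤ √(∑ i, ⟪v i, a⟫ ^ 2) + √(∑ i, ⟪v i, b⟫ ^ 2) := by
  have h := norm_sub_le (WithLp.toLp 2 fun i => ⟪v i, a⟫ : EuclideanSpace ℝ ι)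
    (WithLp.toLp 2 fun i => ⟪v i, b⟫)
  simpa [EuclideanSpace.norm_eq, inner_sub_right] using h

/-- The deterministic part of the analysis of ridge regression. The error is the difference of the
bias `z` and of the noise term `y`, whose norms are bounded separately; the identity
`‖w‖² = ‖z‖² + 2 ⟪z, V z⟫ / lam + ‖V z / lam‖²` for `w = z + V z / lam` bounds the bias. -/
theorem ridge_error_bounds {lam R K : ℝ} (hlam : 0 < lam) (v : ι → Feat d) (r : ι → ℝ)
    (w : Feat d) (hw : ‖w‖ ≤ R) (hK : 0 ≤ K)
    (hnoise : ∀ y : Feat d,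
      lam • y + (gram v).toEuclideanLin y = ∑ i, (r i - ⟪w, v i⟫) • v i →
        ⟪y, ∑ i, (r i - ⟪w, v i⟫) • v i⟫ ≤ K ^ 2) :
    ‖ridge lam v r‖ ≤ R + K / √lam ∧ ‖w - ridge lam v r‖ ≤ R + K / √lam ∧
      √(∑ i, ⟪v i, w - ridge lam v r⟫ ^ 2) ≤ √lam * R / 2 + K := by
  set V := (gram v).toEuclideanLin with hV
  set η := ∑ i, (r i - ⟪w, v i⟫) • v i with hη
  have hsl : 0 < √lam := Real.sqrt_pos.mpr hlam
  have hsl2 : √lam ^ 2 = lam := Real.sq_sqrt hlam.le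
  have hR : 0 ≤ R := (norm_nonneg w).trans hw
  obtain ⟨z, hz⟩ := exists_ridge_solution hlam v (lam • w)
  obtain ⟨y, hy⟩ := exists_ridge_solution hlam v η
  rw [← hV] at hz hy
  have hquad : ∀ u, ⟪u, V u⟫ = ∑ i, ⟪v i, u⟫ ^ 2 := inner_gram_self v
  have hinj : ∀ a b : Feat d, lam • a + V a = lam • b + V b → a = b := by
    intro a b hab
    have h0 : lam • (a - b) + V (a - b) = 0 := by
      rw [smul_sub, map_sub, ← sub_eq_zero.mpr hab]; abel
    have h1 : lam * ‖a - b‖ ^ 2 + ∑ i, ⟪v i, a - b⟫ ^ 2 = 0 := by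
      rw [← hquad, ← real_inner_self_eq_norm_sq, ← inner_smul_right, ← inner_add_right, h0,
        inner_zero_right]
    have h2 : 0 ≤ ∑ i, ⟪v i, a - b⟫ ^ 2 := Finset.sum_nonneg fun i _ => sq_nonneg _
    have h3 : ‖a - b‖ ^ 2 ≤ 0 := by
      by_contra hcon
      have := mul_pos hlam (not_le.mp hcon)
      linarith
    exact sub_eq_zero.mp (norm_eq_zero.mp (by nlinarith [norm_nonneg (a - b)]))
  have hridge : ridge lam v r = w - z + y := by
    apply hinj
    rw [hV, ridge_normal_equation hlam, ← hV]
    have h1 : ∑ i, r i • v i = V w + η := by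
      rw [hV, gram_toEuclideanLin_apply, hη, ← Finset.sum_add_distrib]
      refine Finset.sum_congr rfl fun i _ => ?_
      rw [← add_smul, real_inner_comm]
      congr 1; ring
    rw [h1, ← hy, map_add, map_sub, smul_add, smul_sub, ← hz]
    abel
  -- the bias
  have hVz : V z = lam • (w - z) := by rw [smul_sub, ← hz]; abel
  have hbias : ‖w‖ ^ 2 = ‖z‖ ^ 2 + 2 * (⟪z, V z⟫ / lam) + ‖w - z‖ ^ 2 := by
    have h1 : ⟪z, V z⟫ / lam = ⟪z, w - z⟫ := by
      rw [hVz, inner_smul_right]; field_simp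
    rw [h1, ← norm_add_sq_real]
    congr 2; abel
  have hzV0 : 0 ≤ ⟪z, V z⟫ := by rw [hquad]; exact Finset.sum_nonneg fun i _ => sq_nonneg _
  have hzV0' : 0 ≤ ⟪z, V z⟫ / lam := div_nonneg hzV0 hlam.le
  have hwsq : ‖w‖ ^ 2 ≤ R ^ 2 := pow_le_pow_left₀ (norm_nonneg w) hw 2
  have hznorm : ‖z‖ ≤ R := abs_le_of_sq_le_sq' (by nlinarith [sq_nonneg ‖w - z‖]) hR |>.2
  have hwznorm : ‖w - z‖ ≤ R := abs_le_of_sq_le_sq' (by nlinarith [sq_nonneg ‖z‖]) hR |>.2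
  have hzV : √(∑ i, ⟪v i, z⟫ ^ 2) ≤ √lam * R / 2 := by
    rw [← hquad]
    refine Real.sqrt_le_iff.mpr ⟨by positivity, ?_⟩
    have h1 : ⟪z, w - z⟫ * lam = ⟪z, V z⟫ := by rw [hVz, inner_smul_right]; ring
    have h2 := norm_sub_sq_real z (w - z)
    have h3 : 0 ≤ ‖z - (w - z)‖ ^ 2 := sq_nonneg _
    have h4 : ⟪z, V z⟫ / lam = ⟪z, w - z⟫ := by rw [← h1]; field_simp
    rw [h4] at hbias
    have h5 : 4 * ⟪z, w - z⟫ ≤ R ^ 2 := by linarith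
    have h6 : (√lam * R / 2) ^ 2 = lam * R ^ 2 / 4 := by rw [div_pow, mul_pow, hsl2]; norm_num
    rw [h6, ← h1]
    nlinarith
  -- the noise
  have hyK := hnoise y hy
  have hyy : lam * ‖y‖ ^ 2 + ∑ i, ⟪v i, y⟫ ^ 2 ≤ K ^ 2 := by
    refine le_trans (le_of_eq ?_) hyK
    rw [← hquad, ← real_inner_self_eq_norm_sq, ← inner_smul_right, ← inner_add_right, hy]
  have hysum : 0 ≤ ∑ i, ⟪v i, y⟫ ^ 2 := Finset.sum_nonneg fun i _ => sq_nonneg _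
  have hynorm : ‖y‖ ≤ K / √lam := by
    rw [le_div_iff₀ hsl]
    refine abs_le_of_sq_le_sq' ?_ hK |>.2
    rw [mul_pow, hsl2]; linarith
  have hyV : √(∑ i, ⟪v i, y⟫ ^ 2) ≤ K :=
    Real.sqrt_le_iff.mpr ⟨hK, by nlinarith [mul_nonneg hlam.le (sq_nonneg ‖y‖)]⟩
  have hdiff : w - ridge lam v r = z - y := by rw [hridge]; abel
  refine ⟨?_, ?_, ?_⟩
  · rw [hridge]
    exact (norm_add_le _ _).trans (add_le_add hwznorm hynorm)
  · rw [hdiff]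
    exact (norm_sub_le _ _).trans (add_le_add hznorm hynorm)
  · rw [hdiff]
    exact (sqrt_sum_inner_sq_sub_le v z y).trans (add_le_add hzV hyV)

end LinearRegression

/-! ### Concentration for independent samples -/

section Concentration

/-- Hoeffding's lemma, in multiplicative form. -/
theorem lintegral_exp_mul_sub_mean_le_one {Ω : Type*} [MeasurableSpace Ω] (μ : Measure Ω)
    [IsProbabilityMeasure μ] {Y : Ω → ℝ} (hY : Measurable Y) {a b : ℝ}
    (hab : ∀ᵐ ω ∂μ, Y ω ∈ Icc a b) (t : ℝ) :
    ∫⁻ ω, ENNReal.ofReal (Real.exp (t * (Y ω - ∫ ω', Y ω' ∂μ) - (t * (b - a)) ^ 2 / 8)) ∂μ ≤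
      1 := by
  have h := hasSubgaussianMGF_of_mem_Icc hY.aemeasurable hab
  have hmgf := h.mgf_le t
  have hint := h.integrable_exp_mul t
  have hsplit : ∀ ω, Real.exp (t * (Y ω - ∫ ω', Y ω' ∂μ) - (t * (b - a)) ^ 2 / 8) =
      Real.exp (t * (Y ω - ∫ ω', Y ω' ∂μ)) * Real.exp (-((t * (b - a)) ^ 2 / 8)) := by
    intro ω
    rw [← Real.exp_add, sub_eq_add_neg]
  simp_rw [hsplit]
  rw [← ofReal_integral_eq_lintegral_ofReal (hint.mul_const _)
    (Filter.Eventually.of_forall fun ω => by positivity), integral_mul_const,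
    ← ENNReal.ofReal_one]
  refine ENNReal.ofReal_le_ofReal ?_
  have hc : (((‖b - a‖₊ / 2) ^ 2 : NNReal) : ℝ) * t ^ 2 / 2 = (t * (b - a)) ^ 2 / 8 := by
    push_cast
    rw [div_pow, Real.norm_eq_abs, sq_abs]
    ring
  rw [hc] at hmgf
  calc mgf (fun ω => Y ω - ∫ ω', Y ω' ∂μ) μ t * Real.exp (-((t * (b - a)) ^ 2 / 8))
      ≤ Real.exp ((t * (b - a)) ^ 2 / 8) * Real.exp (-((t * (b - a)) ^ 2 / 8)) := by gcongr
    _ = 1 := by rw [← Real.exp_add, add_neg_cancel, Real.exp_zero]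

theorem lintegral_pi_prod_le_one {I J Z : Type*} [Fintype I] [Fintype J] [MeasurableSpace Z]
    (ρ : I → Measure Z) [∀ i, IsProbabilityMeasure (ρ i)] (e : J → I)
    (he : Function.Injective e) (f : J → Z → ℝ≥0∞) (hf : ∀ j, Measurable (f j))
    (h1 : ∀ j, ∫⁻ z, f j z ∂ρ (e j) ≤ 1) :
    ∫⁻ ω, ∏ j, f j (ω (e j)) ∂Measure.pi ρ ≤ 1 := by
  have hind : iIndepFun (fun (j : J) (ω : I → Z) => f j (ω (e j))) (Measure.pi ρ) :=
    ((iIndepFun_pi (μ := ρ) (X := fun _ => id) fun _ => aemeasurable_id).precomp he).comp f hf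
  rw [lintegral_prod_eq_prod_lintegral_of_indepFun Finset.univ _ hind
    fun j => (hf j).comp (measurable_pi_apply (e j))]
  refine Finset.prod_le_one' fun j _ => ?_
  exact ((measurePreserving_eval ρ (e j)).lintegral_comp (hf j)).trans_le (h1 j)

variable {d : ℕ} {X : Type*} [MeasurableSpace X]

/-- Self-normalized concentration of the noise of a regression with independent samples. The
hypothesis `hsub` says that the noise is sub-Gaussian with variance proxy `1/4`, given the
feature. -/
theorem measure_regression_noise_le {I J : Type*} [Fintype I] [Fintype J]
    (ρ : I → Measure (X × ℝ)) [∀ i, IsProbabilityMeasure (ρ i)] (e : J → I)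
    (he : Function.Injective e) (f : J → X → Feat d) (hf : ∀ j, Measurable (f j))
    (hf1 : ∀ j x, ‖f j x‖ ≤ 1) (w : Feat d)
    (hsub : ∀ j (u : Feat d), ∫⁻ z, ENNReal.ofReal
      (Real.exp (2 * ⟪f j z.1, u⟫ * (z.2 - ⟪w, f j z.1⟫) - ⟪f j z.1, u⟫ ^ 2 / 2)) ∂ρ (e j) ≤ 1)
    {lam δ N : ℝ} (hlam : 0 < lam) (hδ : 0 < δ) (hδ1 : δ ≤ 1) (hN : 0 ≤ N)
    (hcard : (Fintype.card J : ℝ) ≤ d * N) :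
    Measure.pi ρ {ω | ¬ ∀ y : Feat d,
      lam • y + (gram fun j => f j (ω (e j)).1).toEuclideanLin y =
          ∑ j, ((ω (e j)).2 - ⟪w, f j (ω (e j)).1⟫) • f j (ω (e j)).1 →
        ⟪y, ∑ j, ((ω (e j)).2 - ⟪w, f j (ω (e j)).1⟫) • f j (ω (e j)).1⟫ ≤
          (√(2 * Real.log (1 / δ) + d * Real.log (1 + N / lam)) / 2) ^ 2} ≤
      ENNReal.ofReal δ := by
  have hfm : ∀ j, Measurable fun ω : I → X × ℝ => f j (ω (e j)).1 := fun j =>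
    (hf j).comp (measurable_fst.comp (measurable_pi_apply (e j)))
  have hrm : ∀ j, Measurable fun ω : I → X × ℝ => (ω (e j)).2 := fun j =>
    measurable_snd.comp (measurable_pi_apply (e j))
  let η : (I → X × ℝ) → Feat d := fun ω =>
    ∑ j, ((ω (e j)).2 - ⟪w, f j (ω (e j)).1⟫) • f j (ω (e j)).1
  have hηm : Measurable η := Finset.measurable_sum _ fun j _ =>
    ((hrm j).sub (measurable_const.inner (hfm j))).smul (hfm j)
  have hVm : Measurable fun p : Feat d × (I → X × ℝ) =>
      ⟪p.1, (gram fun j => f j (p.2 (e j)).1).toEuclideanLin p.1⟫ := by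
    simp_rw [inner_gram_self]
    exact Finset.measurable_sum _ fun j _ =>
      (((hfm j).comp measurable_snd).inner measurable_fst).pow_const 2
  have hmgf : ∀ u : Feat d, ∫⁻ ω, ENNReal.ofReal (Real.exp (⟪u, (2 : ℝ) • η ω⟫ -
      ⟪u, (gram fun j => f j (ω (e j)).1).toEuclideanLin u⟫ / 2)) ∂Measure.pi ρ ≤ 1 := by
    intro u
    refine le_trans (le_of_eq (lintegral_congr fun ω => ?_))
      (lintegral_pi_prod_le_one ρ e he (fun j z => ENNReal.ofReal
        (Real.exp (2 * ⟪f j z.1, u⟫ * (z.2 - ⟪w, f j z.1⟫) - ⟪f j z.1, u⟫ ^ 2 / 2)))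
        (fun j => ?_) fun j => hsub j u)
    · rw [← ENNReal.ofReal_prod_of_nonneg fun j _ => Real.exp_nonneg _, ← Real.exp_sum,
        inner_gram_self, Finset.sum_sub_distrib, ← Finset.sum_div]
      congr 3
      simp only [η, inner_smul_right, inner_sum, Finset.mul_sum]
      refine Finset.sum_congr rfl fun j _ => ?_
      rw [real_inner_comm u]; ring
    · have h1 : Measurable fun z : X × ℝ => f j z.1 := (hf j).comp measurable_fst
      have h2 : Measurable fun z : X × ℝ => ⟪f j z.1, u⟫ := h1.inner measurable_const
      have h3 : Measurable fun z : X × ℝ => ⟪w, f j z.1⟫ := measurable_const.inner h1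
      fun_prop
  -- variance proxy `1/4` means that twice the noise satisfies the hypothesis with the Gram matrix
  have hmain := measure_selfNormalized_ge_le (Measure.pi ρ) (S := fun ω => (2 : ℝ) • η ω)
    (hηm.const_smul (2 : ℝ)) (fun ω => gram_posSemidef fun j => f j (ω (e j)).1) hVm hmgf hlam hδ
  refine (measure_mono fun ω hω => ?_).trans hmain
  simp only [mem_ofPred_eq, not_forall, not_le] at hω
  obtain ⟨y, hy, hlt⟩ := hω
  refine ⟨(2 : ℝ) • y, ?_, ?_⟩
  · rw [map_smul, smul_comm, ← smul_add, hy]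
  · have hpos : 0 < lam ^ d := pow_pos hlam d
    have hdet := det_ridge_le hlam (fun j => f j (ω (e j)).1) (fun j => hf1 j _) hcard
    have hdpos := (posDef_ridge hlam (gram_posSemidef fun j => f j (ω (e j)).1)).det_pos
    have hlog : Real.log ((lam • (1 : Matrix (Fin d) (Fin d) ℝ) +
        gram fun j => f j (ω (e j)).1).det / lam ^ d) ≤ d * Real.log (1 + N / lam) := by
      rw [← Real.log_pow]
      refine Real.log_le_log (div_pos hdpos hpos) ?_
      rw [div_le_iff₀ hpos, ← mul_pow, add_mul, div_mul_cancel₀ _ hlam.ne', one_mul]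
      exact hdet
    have hsq : √(2 * Real.log (1 / δ) + d * Real.log (1 + N / lam)) ^ 2 =
        2 * Real.log (1 / δ) + d * Real.log (1 + N / lam) := by
      refine Real.sq_sqrt (add_nonneg (mul_nonneg two_pos.le (Real.log_nonneg ?_))
        (mul_nonneg (Nat.cast_nonneg d) (Real.log_nonneg ?_)))
      · rw [le_div_iff₀ hδ]; linarith
      · have := div_nonneg hN hlam.le
        linarith
    rw [div_pow, hsq] at hlt
    rw [inner_smul_left, inner_smul_right]
    simp only [conj_trivial]
    change _ < ⟪y, η ω⟫ at hlt
    linarith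

/-- Concentration of an average of `n` bounded vectors around its mean, in the Euclidean norm. -/
theorem measure_average_deviation_le {I : Type*} [Fintype I] {n : ℕ} (hn : 1 ≤ n)
    (ρ : I → Measure (X × ℝ)) [∀ i, IsProbabilityMeasure (ρ i)] (e : Fin n → I)
    (he : Function.Injective e) (ν : Measure X) [IsProbabilityMeasure ν]
    (hν : ∀ m, (ρ (e m)).map Prod.fst = ν) (f : X → Feat d) (hf : Measurable f)
    (hf1 : ∀ x, ‖f x‖ ≤ 1) {δ η : ℝ} (hδ : 0 < δ) (hη : 0 ≤ η)
    (hη2 : 2 * (2 * Real.log (1 / δ) + d * Real.log 2) / n ≤ η ^ 2) :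
    Measure.pi ρ {ω | ¬ ‖(n : ℝ)⁻¹ • ∑ m, f (ω (e m)).1 - ∫ x, f x ∂ν‖ ≤ η} ≤
      ENNReal.ofReal δ := by
  have hn0 : (0 : ℝ) < n := by exact_mod_cast hn
  set c := ∫ x, f x ∂ν with hc
  have hfi : Integrable f ν := Integrable.of_bound hf.aestronglyMeasurable 1
    (Filter.Eventually.of_forall hf1)
  have hfm : ∀ m, Measurable fun ω : I → X × ℝ => f (ω (e m)).1 := fun m =>
    hf.comp (measurable_fst.comp (measurable_pi_apply (e m)))
  let S : (I → X × ℝ) → Feat d := fun ω => ∑ m, (f (ω (e m)).1 - c)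
  have hSm : Measurable S := Finset.measurable_sum _ fun m _ => (hfm m).sub_const c
  have hid : ∀ u : Feat d, ((n : ℝ) • (1 : Matrix (Fin d) (Fin d) ℝ)).toEuclideanLin u =
      (n : ℝ) • u := by
    intro u
    rw [map_smul, Matrix.toLpLin_one]; rfl
  have hmgf : ∀ u : Feat d, ∫⁻ ω, ENNReal.ofReal (Real.exp (⟪u, S ω⟫ -
      ⟪u, ((n : ℝ) • (1 : Matrix (Fin d) (Fin d) ℝ)).toEuclideanLin u⟫ / 2)) ∂Measure.pi ρ ≤
        1 := by
    intro u
    have hum : Measurable fun x => ⟪u, f x⟫ := measurable_const.inner hf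
    have hgm : Measurable fun x => ENNReal.ofReal
        (Real.exp (1 * (⟪u, f x⟫ - ∫ x', ⟪u, f x'⟫ ∂ν) - (1 * (‖u‖ - -‖u‖)) ^ 2 / 8)) := by
      fun_prop
    refine le_trans (le_of_eq (lintegral_congr fun ω => ?_))
      (lintegral_pi_prod_le_one ρ e he (fun m z => ENNReal.ofReal
        (Real.exp (1 * (⟪u, f z.1⟫ - ∫ x', ⟪u, f x'⟫ ∂ν) - (1 * (‖u‖ - -‖u‖)) ^ 2 / 8)))
        (fun m => hgm.comp measurable_fst) fun m => ?_)
    · rw [← ENNReal.ofReal_prod_of_nonneg fun j _ => Real.exp_nonneg _, ← Real.exp_sum,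
        Finset.sum_sub_distrib, hid, inner_smul_right, real_inner_self_eq_norm_sq,
        integral_inner hfi]
      congr 2
      simp only [S, inner_sum, inner_sub_right, Finset.sum_const, Finset.card_univ,
        Fintype.card_fin, nsmul_eq_mul, one_mul]
      ring
    · rw [← lintegral_map (f := fun x => ENNReal.ofReal
        (Real.exp (1 * (⟪u, f x⟫ - ∫ x', ⟪u, f x'⟫ ∂ν) - (1 * (‖u‖ - -‖u‖)) ^ 2 / 8)))
        hgm measurable_fst, hν m]
      refine lintegral_exp_mul_sub_mean_le_one ν hum (Filter.Eventually.of_forall fun x => ?_) 1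
      have h1 := (abs_real_inner_le_norm u (f x)).trans
        (mul_le_of_le_one_right (norm_nonneg u) (hf1 x))
      exact abs_le.mp h1
  have hVm : Measurable fun p : Feat d × (I → X × ℝ) =>
      ⟪p.1, ((n : ℝ) • (1 : Matrix (Fin d) (Fin d) ℝ)).toEuclideanLin p.1⟫ := by
    simp_rw [hid]
    fun_prop
  -- the mixing weight `lam = n` matches `V = n I`, so the determinant ratio is `2 ^ d`
  have hmain := measure_selfNormalized_ge_le (Measure.pi ρ) (S := S)
    (V := fun _ => (n : ℝ) • (1 : Matrix (Fin d) (Fin d) ℝ)) hSm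
    (fun _ => (Matrix.PosDef.one.smul hn0).posSemidef) hVm hmgf hn0 hδ
  refine (measure_mono fun ω hω => ?_).trans hmain
  simp only [mem_ofPred_eq, not_le] at hω
  have hSn : (n : ℝ)⁻¹ • ∑ m, f (ω (e m)).1 - c = (n : ℝ)⁻¹ • S ω := by
    simp only [S, Finset.sum_sub_distrib, Finset.sum_const, Finset.card_univ, Fintype.card_fin,
      smul_sub]
    rw [← Nat.cast_smul_eq_nsmul ℝ, smul_smul, inv_mul_cancel₀ hn0.ne', one_smul]
  rw [hSn, norm_smul, Real.norm_eq_abs, abs_of_pos (inv_pos.mpr hn0)] at hω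
  refine ⟨(2 * (n : ℝ))⁻¹ • S ω, ?_, ?_⟩
  · rw [hid, ← add_smul, smul_smul]
    rw [show ((n : ℝ) + n) * (2 * (n : ℝ))⁻¹ = 1 by field_simp; ring, one_smul]
  · have hdet : ((n : ℝ) • (1 : Matrix (Fin d) (Fin d) ℝ) +
        (n : ℝ) • (1 : Matrix (Fin d) (Fin d) ℝ)).det / (n : ℝ) ^ d = 2 ^ d := by
      rw [← add_smul, Matrix.det_smul, Matrix.det_one, mul_one, Fintype.card_fin, ← div_pow]
      congr 1
      field_simp; ring
    simp only [hdet, Real.log_pow, inner_smul_left, real_inner_self_eq_norm_sq, conj_trivial]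
    have h1 : η ^ 2 ≤ ((n : ℝ)⁻¹ * ‖S ω‖) ^ 2 := pow_le_pow_left₀ hη hω.le 2
    have h2 := hη2.trans h1
    rw [mul_pow, inv_pow, div_le_iff₀ hn0] at h2
    have h3 : ((n : ℝ) ^ 2)⁻¹ * ‖S ω‖ ^ 2 * n = 2 * ((2 * (n : ℝ))⁻¹ * ‖S ω‖ ^ 2) := by
      field_simp
    rw [h3] at h2
    linarith

end Concentration

/-! ### Exactness of fitted Q-iteration -/

section Planning

variable {X A : Type*} [MeasurableSpace X] [MeasurableSpace A] {d H : ℕ}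

theorem ArgmaxOracle.iSup_eq {φ : ℕ → X → A → Feat d} (o : ArgmaxOracle H φ) {h : ℕ} (hh : h < H)
    (θ : Feat d) (x : X) : ⨆ a, ⟪φ h x a, θ⟫ = ⟪φ h x (o.pick h θ x), θ⟫ := by
  have : Nonempty A := ⟨o.pick h θ x⟩
  exact le_antisymm (ciSup_le fun a => o.pick_max h hh θ x a)
    (le_ciSup (f := fun a => ⟪φ h x a, θ⟫) ⟨_, by rintro _ ⟨a, rfl⟩; exact o.pick_max h hh θ x a⟩
      (o.pick h θ x))

/-- As the features are bounded, linear Bellman completeness extends from `boundedParams` to all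
parameters, by homogeneity. -/
theorem LinearBellmanComplete.exists_backup {M : DetMDP X A} {φ : ℕ → X → A → Feat d}
    (hlbc : LinearBellmanComplete M H φ) (hfeat : FeatureAssumption M H φ) {h : ℕ}
    (hh : h + 1 < H) (θ : Feat d) :
    ∃ θ' : Feat d, ∀ x a, ⟪φ h x a, θ'⟫ = ⨆ a', ⟪φ (h + 1) (M.next h x a) a', θ⟫ := by
  obtain ⟨T, hT⟩ := hlbc h hh
  have hK : 0 < ‖θ‖ + 1 := by positivity
  have hmem : (‖θ‖ + 1)⁻¹ • θ ∈ boundedParams φ (h + 1) := by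
    intro x a
    rw [inner_smul_right, abs_mul, abs_of_pos (inv_pos.mpr hK), inv_mul_le_iff₀ hK, mul_one]
    refine (abs_real_inner_le_norm _ _).trans ?_
    nlinarith [hfeat.norm_le (h + 1) hh x a, norm_nonneg θ]
  refine ⟨(‖θ‖ + 1) • T ((‖θ‖ + 1)⁻¹ • θ), fun x a => ?_⟩
  rw [inner_smul_right, (hT _ hmem).2 x a, Real.mul_iSup_of_nonneg hK.le]
  refine iSup_congr fun a' => ?_
  rw [inner_smul_right, mul_inv_cancel_left₀ hK.ne']

/-- Transitions being deterministic, the regression targets of fitted Q-iteration are noiseless,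
so the Bellman equation holds exactly for features in the span of the data. -/
theorem inner_fqiParam_of_mem_span {M : DetMDP X A} {φ : ℕ → X → A → Feat d}
    (hlbc : LinearBellmanComplete M H φ) (hfeat : FeatureAssumption M H φ) (w : ℕ → Feat d)
    (Ψ : ℕ → Finset (Policy X A)) (n : ℕ) (s : (ℓ : Fin H) → Starts X (Ψ ℓ) n) {ℓ : ℕ}
    (hℓ : ℓ + 1 < H) (x : X) (a : A)
    (hx : φ ℓ x a ∈ Submodule.span ℝ (range fun p : Ψ ℓ × Fin n =>
      M.feature φ (p.1 : Policy X A) ℓ (s ⟨ℓ, by omega⟩ p))) :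
    ⟪φ ℓ x a, fqiParam M H φ w Ψ n s ℓ⟫ = ⟪φ ℓ x a, w ℓ⟫ +
      ⨆ a', ⟪φ (ℓ + 1) (M.next ℓ x a) a', fqiParam M H φ w Ψ n s (ℓ + 1)⟫ := by
  obtain ⟨θ', hθ'⟩ := hlbc.exists_backup hfeat hℓ (fqiParam M H φ w Ψ n s (ℓ + 1))
  rw [← hθ', ← inner_add_right]
  conv_lhs => rw [fqiParam, dif_pos hℓ]
  refine inner_minNormLS_of_mem_span _ _ _ _ (fun p => ?_) hx
  rw [inner_add_right]
  congr 1
  exact (hθ' _ _).symm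

theorem fqiParam_last (M : DetMDP X A) (φ : ℕ → X → A → Feat d) (w : ℕ → Feat d)
    (Ψ : ℕ → Finset (Policy X A)) (n : ℕ) (s : (ℓ : Fin H) → Starts X (Ψ ℓ) n) {ℓ : ℕ}
    (hℓ : ¬ ℓ + 1 < H) : fqiParam M H φ w Ψ n s ℓ = w ℓ := by
  rw [fqiParam, dif_neg hℓ]

/-- If the data of fitted Q-iteration span the subspaces `S`, then the greedy policy is optimal,
for the rewards `⟪w, φ⟫` used in planning, from every covered initial state. -/
theorem sum_inner_feature_le_greedy {M : DetMDP X A} {φ : ℕ → X → A → Feat d}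
    (hlbc : LinearBellmanComplete M H φ) (hfeat : FeatureAssumption M H φ)
    (o : ArgmaxOracle H φ) (w : ℕ → Feat d) (Ψ : ℕ → Finset (Policy X A)) (n : ℕ)
    (s : (ℓ : Fin H) → Starts X (Ψ ℓ) n) (S : ℕ → Submodule ℝ (Feat d))
    (hS : ∀ ℓ : Fin H, S ℓ ≤ Submodule.span ℝ (range fun p : Ψ ℓ × Fin n =>
      M.feature φ (p.1 : Policy X A) ℓ (s ℓ p)))
    {x : X} (hx : x ∈ coveredStates M H φ S) (π : Policy X A) :
    ∑ h ∈ Finset.range H, ⟪w h, M.feature φ π h x⟫ ≤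
      ∑ h ∈ Finset.range H, ⟪w h, M.feature φ (o.greedy (fqiParam M H φ w Ψ n s)) h x⟫ := by
  set θ := fqiParam M H φ w Ψ n s with hθ
  -- the optimal value-to-go predicted along the trajectory of a policy
  let t : Policy X A → ℕ → ℝ := fun ρ h =>
    if h < H then ⟪φ h (M.state ρ x h) (o.pick h (θ h) (M.state ρ x h)), θ h⟫ else 0
  have hstep : ∀ (ρ : Policy X A), ∀ h < H,
      ⟪w h, M.feature φ ρ h x⟫ = ⟪M.feature φ ρ h x, θ h⟫ - t ρ (h + 1) := by
    intro ρ h hh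
    rw [real_inner_comm]
    by_cases hh1 : h + 1 < H
    · have hmem : M.feature φ ρ h x ∈ Submodule.span ℝ (range fun p : Ψ h × Fin n =>
          M.feature φ (p.1 : Policy X A) h (s ⟨h, by omega⟩ p)) :=
        hS ⟨h, hh⟩ (hx h hh1 (Submodule.subset_span ⟨ρ, rfl⟩))
      have hbell := inner_fqiParam_of_mem_span hlbc hfeat w Ψ n s hh1
        (M.state ρ x h) (M.action ρ x h) hmem
      rw [o.iSup_eq hh1] at hbell
      simp only [t, if_pos hh1]
      exact eq_sub_of_add_eq hbell.symm
    · simp only [t, if_neg hh1, sub_zero, hθ, fqiParam_last M φ w Ψ n s hh1]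
  have htel : ∀ ρ, ∑ h ∈ Finset.range H, (t ρ h - t ρ (h + 1)) = t ρ 0 := by
    intro ρ
    rw [Finset.sum_range_sub']
    simp [t]
  calc ∑ h ∈ Finset.range H, ⟪w h, M.feature φ π h x⟫
      ≤ ∑ h ∈ Finset.range H, (t π h - t π (h + 1)) := by
        refine Finset.sum_le_sum fun h hh => ?_
        have hh := Finset.mem_range.mp hh
        rw [hstep π h hh]
        refine sub_le_sub_right ?_ _
        simp only [t, if_pos hh]
        exact o.pick_max h hh (θ h) _ _
    _ = t (o.greedy θ) 0 := by rw [htel]; rfl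
    _ = _ := by
        rw [← htel]
        refine Finset.sum_congr rfl fun h hh => ?_
        have hh := Finset.mem_range.mp hh
        rw [hstep _ h hh]
        simp only [t, if_pos hh]
        rfl

end Planning

/-! ### Regret of the greedy policy -/

section Regret

variable {X A : Type*} [MeasurableSpace X] [MeasurableSpace A] {d H : ℕ}

theorem FeatureAssumption.measurable_feature {M : DetMDP X A} {φ : ℕ → X → A → Feat d}
    (hfeat : FeatureAssumption M H φ) (π : Policy X A) {h : ℕ} (hh : h < H) :
    Measurable (M.feature φ π h) :=
  (hfeat.meas h hh).comp (M.measurable_state_action π h)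

theorem FeatureAssumption.norm_feature_le {M : DetMDP X A} {φ : ℕ → X → A → Feat d}
    (hfeat : FeatureAssumption M H φ) (π : Policy X A) {h : ℕ} (hh : h < H) (x : X) :
    ‖M.feature φ π h x‖ ≤ 1 :=
  hfeat.norm_le h hh _ _

theorem FeatureAssumption.integrable_feature {M : DetMDP X A} {φ : ℕ → X → A → Feat d}
    (hfeat : FeatureAssumption M H φ) (π : Policy X A) {h : ℕ} (hh : h < H) :
    Integrable (M.feature φ π h) M.init :=
  Integrable.of_bound (hfeat.measurable_feature π hh).aestronglyMeasurable 1
    (Filter.Eventually.of_forall (hfeat.norm_feature_le π hh))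

/-- An integrand that is nonpositive off an event of probability at most `ε`, and at most `B`
there, has integral at most `B ε`. -/
theorem integral_le_mul_of_probAtLeast {μ : Measure X} [IsProbabilityMeasure μ] {g : X → ℝ}
    (hg : Integrable g μ) {E : Set X} {B ε : ℝ} (hB : 0 ≤ B) (hE : ProbAtLeast μ (1 - ε) E)
    (hgE : ∀ x ∈ E, g x ≤ 0) (hgB : ∀ x, g x ≤ B) : ∫ x, g x ∂μ ≤ B * ε := by
  obtain ⟨G, hGm, hGE, hGp⟩ := hE
  have hle : ∀ x, g x ≤ Gᶜ.indicator (fun _ => B) x := by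
    intro x
    by_cases hx : x ∈ G
    · simpa [hx] using hgE x (hGE hx)
    · simpa [hx] using hgB x
  calc ∫ x, g x ∂μ ≤ ∫ x, Gᶜ.indicator (fun _ => B) x ∂μ :=
        integral_mono hg ((integrable_const B).indicator hGm.compl) hle
    _ = (1 - μ.real G) * B := by
        rw [integral_indicator_const _ hGm.compl, probReal_compl_eq_one_sub hGm, smul_eq_mul]
    _ ≤ B * ε := by nlinarith

/-- The regret of the greedy policy in terms of the errors of the reward parameters `w` used in
planning: by `B` in norm, and by `b` in total on the mean features of the policies of `Γ`. -/
theorem integral_value_sub_greedy_le {M : DetMDP X A} {φ : ℕ → X → A → Feat d}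
    (hlbc : LinearBellmanComplete M H φ) (hfeat : FeatureAssumption M H φ)
    (o : ArgmaxOracle H φ) {wstar w : ℕ → Feat d} {Ψ Γ : ℕ → Finset (Policy X A)} {n : ℕ}
    {s : (ℓ : Fin H) → Starts X (Ψ ℓ) n} {S : ℕ → Submodule ℝ (Feat d)}
    {B b εspan εconc : ℝ} (hB : 0 ≤ B)
    (hwstar : ∀ h < H, ∀ x a, M.meanReward h x a = ⟪wstar h, φ h x a⟫)
    (hw : ∀ h < H, ‖w h‖ ≤ B) (herr : ∀ h < H, ‖wstar h - w h‖ ≤ B)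
    (hmean : ∀ h < H, ∑ ρ ∈ Γ h, |⟪wstar h - w h, M.meanFeature φ ρ h⟫| ≤ b)
    (hspan : ∀ ℓ < H, ∀ ρ : Policy X A, ∃ β : Policy X A → ℝ,
      (∀ π ∈ Γ ℓ, β π ∈ Icc (-2 : ℝ) 2) ∧
        ‖M.meanFeature φ ρ ℓ - ∑ π ∈ Γ ℓ, β π • M.meanFeature φ π ℓ‖ ≤ εspan)
    (hconc : ProbAtLeast M.init (1 - εconc) (coveredStates M H φ S))
    (hS : ∀ ℓ : Fin H, S ℓ ≤ Submodule.span ℝ (range fun p : Ψ ℓ × Fin n =>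
      M.feature φ (p.1 : Policy X A) ℓ (s ℓ p)))
    (π : Policy X A) :
    ∫ x, (M.value H π x - M.value H (o.greedy (fqiParam M H φ w Ψ n s)) x) ∂M.init ≤
      ∑ _h ∈ Finset.range H, 2 * (2 * b + B * εspan) + H * (2 * B) * εconc := by
  set π' := o.greedy (fqiParam M H φ w Ψ n s) with hπ'
  have hpolicy : ∀ (ρ : Policy X A), ∀ h < H,
      |⟪wstar h - w h, M.meanFeature φ ρ h⟫| ≤ 2 * b + B * εspan := by
    intro ρ h hh
    obtain ⟨β, hβ, hβρ⟩ := hspan h hh ρ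
    set c := ∑ π ∈ Γ h, β π • M.meanFeature φ π h with hc
    have h1 : ⟪wstar h - w h, M.meanFeature φ ρ h⟫ =
        ⟪wstar h - w h, c⟫ + ⟪wstar h - w h, M.meanFeature φ ρ h - c⟫ := by
      rw [← inner_add_right, add_sub_cancel]
    have h2 : |⟪wstar h - w h, c⟫| ≤ 2 * b := by
      rw [hc, inner_sum]
      refine (Finset.abs_sum_le_sum_abs _ _).trans
        (le_trans ?_ (mul_le_mul_of_nonneg_left (hmean h hh) two_pos.le))
      rw [Finset.mul_sum]
      refine Finset.sum_le_sum fun π hπ => ?_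
      rw [inner_smul_right, abs_mul]
      exact mul_le_mul_of_nonneg_right (abs_le.mpr (hβ π hπ)) (abs_nonneg _)
    have h3 : |⟪wstar h - w h, M.meanFeature φ ρ h - c⟫| ≤ B * εspan :=
      (abs_real_inner_le_norm _ _).trans
        (mul_le_mul (herr h hh) hβρ (norm_nonneg _) hB)
    rw [h1]
    exact (abs_add_le _ _).trans (add_le_add h2 h3)
  have hint : ∀ (u : ℕ → Feat d) (ρ : Policy X A), ∀ h ∈ Finset.range H,
      Integrable (fun x => ⟪u h, M.feature φ ρ h x⟫) M.init := fun u ρ h hh =>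
    (hfeat.integrable_feature ρ (Finset.mem_range.mp hh)).const_inner (u h)
  have hsplit : ∀ x, M.value H π x - M.value H π' x =
      (∑ h ∈ Finset.range H, ⟪wstar h - w h, M.feature φ π h x⟫ -
        ∑ h ∈ Finset.range H, ⟪wstar h - w h, M.feature φ π' h x⟫) +
      (∑ h ∈ Finset.range H, ⟪w h, M.feature φ π h x⟫ -
        ∑ h ∈ Finset.range H, ⟪w h, M.feature φ π' h x⟫) := by
    intro x
    have hval : ∀ ρ, M.value H ρ x = ∑ h ∈ Finset.range H, ⟪wstar h, M.feature φ ρ h x⟫ :=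
      fun ρ => Finset.sum_congr rfl fun h hh => hwstar h (Finset.mem_range.mp hh) _ _
    simp only [hval, inner_sub_left, Finset.sum_sub_distrib]
    ring
  have hI : ∀ (u : ℕ → Feat d) (ρ : Policy X A),
      Integrable (fun x => ∑ h ∈ Finset.range H, ⟪u h, M.feature φ ρ h x⟫) M.init := fun u ρ =>
    integrable_finsetSum _ (hint u ρ)
  have hE : ∀ (u : ℕ → Feat d) (ρ : Policy X A),
      ∫ x, ∑ h ∈ Finset.range H, ⟪u h, M.feature φ ρ h x⟫ ∂M.init =
        ∑ h ∈ Finset.range H, ⟪u h, M.meanFeature φ ρ h⟫ := by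
    intro u ρ
    rw [integral_finsetSum _ (hint u ρ)]
    exact Finset.sum_congr rfl fun h hh =>
      integral_inner (hfeat.integrable_feature ρ (Finset.mem_range.mp hh)) (u h)
  have hIsub : ∀ u : ℕ → Feat d, Integrable (fun x =>
      ∑ h ∈ Finset.range H, ⟪u h, M.feature φ π h x⟫ -
        ∑ h ∈ Finset.range H, ⟪u h, M.feature φ π' h x⟫) M.init := fun u =>
    (hI u π).sub (hI u π')
  simp_rw [hsplit]
  rw [integral_add (hIsub fun h => wstar h - w h) (hIsub w),
    integral_sub (hI (fun h => wstar h - w h) π) (hI (fun h => wstar h - w h) π'),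
    hE (fun h => wstar h - w h), hE (fun h => wstar h - w h), ← Finset.sum_sub_distrib]
  refine add_le_add (Finset.sum_le_sum fun h hh => ?_) ?_
  · have hh := Finset.mem_range.mp hh
    have h1 := (abs_le.mp (hpolicy π h hh)).2
    have h2 := (abs_le.mp (hpolicy π' h hh)).1
    linarith
  · refine integral_le_mul_of_probAtLeast (hIsub w) (by positivity) hconc
      (fun x hx => ?_) fun x => ?_
    · exact sub_nonpos.mpr (sum_inner_feature_le_greedy hlbc hfeat o w Ψ n s S hS hx π)
    · rw [← Finset.sum_sub_distrib]
      have hterm : ∀ (ρ : Policy X A), ∀ h < H, |⟪w h, M.feature φ ρ h x⟫| ≤ B := fun ρ h hh =>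
        (abs_real_inner_le_norm _ _).trans ((mul_le_of_le_one_right (norm_nonneg _)
          (hfeat.norm_feature_le ρ hh x)).trans (hw h hh))
      refine (Finset.sum_le_card_nsmul _ _ (2 * B) fun h hh => ?_).trans (by simp)
      have hh := Finset.mem_range.mp hh
      have h1 := (abs_le.mp (hterm π h hh)).2
      have h2 := (abs_le.mp (hterm π' h hh)).1
      linarith

/-- The passage from empirical to mean features: Cauchy-Schwarz for the in-sample error of the
regression, and the deviation `η` of the averages. -/
theorem sum_abs_inner_le_of_average {P : Type*} (Q : Finset P) {n : ℕ} (hn : 1 ≤ n)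
    (v : Q × Fin n → Feat d) (m : P → Feat d) (D : Feat d) {B η K : ℝ} (hη : 0 ≤ η)
    (hcard : Q.card ≤ d) (hD : ‖D‖ ≤ B) (hK : √(∑ p, ⟪v p, D⟫ ^ 2) ≤ K)
    (hdev : ∀ π : Q, ‖(n : ℝ)⁻¹ • ∑ k, v (π, k) - m π‖ ≤ η) :
    ∑ π ∈ Q, |⟪D, m π⟫| ≤ √((d : ℝ) / n) * K + d * (B * η) := by
  have hn0 : (0 : ℝ) < n := by exact_mod_cast hn
  have hB : 0 ≤ B := (norm_nonneg D).trans hD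
  have hpt : ∀ π : Q, |⟪D, m π⟫| ≤ (n : ℝ)⁻¹ * ∑ k, |⟪v (π, k), D⟫| + B * η := by
    intro π
    have h1 : ⟪D, m π⟫ = ⟪D, (n : ℝ)⁻¹ • ∑ k, v (π, k)⟫ -
        ⟪D, (n : ℝ)⁻¹ • ∑ k, v (π, k) - m π⟫ := by
      rw [← inner_sub_right, sub_sub_cancel]
    rw [h1]
    refine (abs_sub _ _).trans (add_le_add ?_ ?_)
    · rw [inner_smul_right, abs_mul, abs_of_pos (inv_pos.mpr hn0), inner_sum]
      refine mul_le_mul_of_nonneg_left ((Finset.abs_sum_le_sum_abs _ _).trans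
        (le_of_eq ?_)) (inv_pos.mpr hn0).le
      exact Finset.sum_congr rfl fun k _ => by rw [real_inner_comm]
    · exact (abs_real_inner_le_norm _ _).trans (mul_le_mul hD (hdev π) (norm_nonneg _) hB)
  have hcs : ∑ p, |⟪v p, D⟫| ≤ √(n * d) * K := by
    have h1 := sq_sum_le_card_mul_sum_sq (s := Finset.univ) (f := fun p => |⟪v p, D⟫|)
    simp only [sq_abs, Finset.card_univ, Fintype.card_prod, Fintype.card_coe,
      Fintype.card_fin] at h1
    have hs0 : 0 ≤ ∑ p, ⟪v p, D⟫ ^ 2 := Finset.sum_nonneg fun p _ => sq_nonneg _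
    have h2 : (∑ p, |⟪v p, D⟫|) ^ 2 ≤ (n * d) * ∑ p, ⟪v p, D⟫ ^ 2 := by
      refine h1.trans (mul_le_mul_of_nonneg_right ?_ hs0)
      push_cast
      rw [mul_comm]
      exact mul_le_mul_of_nonneg_left (by exact_mod_cast hcard) hn0.le
    refine (Real.le_sqrt_of_sq_le h2).trans ?_
    rw [Real.sqrt_mul (by positivity)]
    exact mul_le_mul_of_nonneg_left hK (Real.sqrt_nonneg _)
  calc ∑ π ∈ Q, |⟪D, m π⟫| = ∑ π : Q, |⟪D, m π⟫| :=
        (Finset.sum_coe_sort Q fun π => |⟪D, m π⟫|).symm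
    _ ≤ ∑ π : Q, ((n : ℝ)⁻¹ * ∑ k, |⟪v (π, k), D⟫| + B * η) :=
        Finset.sum_le_sum fun π _ => hpt π
    _ = (n : ℝ)⁻¹ * ∑ p, |⟪v p, D⟫| + Q.card * (B * η) := by
        rw [Finset.sum_add_distrib, ← Finset.mul_sum, ← Fintype.sum_prod_type', Finset.sum_const,
          Finset.card_univ, Fintype.card_coe, nsmul_eq_mul]
    _ ≤ (n : ℝ)⁻¹ * (√(n * d) * K) + d * (B * η) := by
        have : (Q.card : ℝ) ≤ d := by exact_mod_cast hcard
        gcongr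
    _ = √((d : ℝ) / n) * K + d * (B * η) := by
        have h1 : (n : ℝ)⁻¹ * √(n * d) = √((d : ℝ) / n) := by
          rw [show (d : ℝ) / n = (n * d) * ((n : ℝ)⁻¹) ^ 2 by field_simp,
            Real.sqrt_mul (x := (n : ℝ) * d) (by positivity), Real.sqrt_sq (by positivity),
            mul_comm]
        rw [← mul_assoc, h1]

end Regret

/-! ### Probability of events -/

section Probability

/-- No measurability of `E` is needed: the complement of a measurable hull of `Eᶜ` is contained in
`E`. -/
theorem probAtLeast_of_measure_compl_le {Ω : Type*} [MeasurableSpace Ω] {μ : Measure Ω}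
    [IsProbabilityMeasure μ] {E : Set Ω} {ε : ℝ} (hε : 0 ≤ ε)
    (h : μ Eᶜ ≤ ENNReal.ofReal ε) : ProbAtLeast μ (1 - ε) E := by
  refine ⟨(toMeasurable μ Eᶜ)ᶜ, (measurableSet_toMeasurable _ _).compl,
    compl_subset_comm.mp (subset_toMeasurable _ _), ?_⟩
  rw [probReal_compl_eq_one_sub (measurableSet_toMeasurable _ _), Measure.real,
    measure_toMeasurable]
  have := ENNReal.toReal_mono ENNReal.ofReal_ne_top h
  rw [ENNReal.toReal_ofReal hε] at this
  linarith

theorem ProbAtLeast.measure_compl_le {Ω : Type*} [MeasurableSpace Ω] {μ : Measure Ω}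
    [IsProbabilityMeasure μ] {E : Set Ω} {ε : ℝ} (h : ProbAtLeast μ (1 - ε) E) :
    μ Eᶜ ≤ ENNReal.ofReal ε := by
  obtain ⟨G, hGm, hGE, hGp⟩ := h
  refine (measure_mono (compl_subset_compl.mpr hGE)).trans ?_
  rw [← ofReal_measureReal, probReal_compl_eq_one_sub hGm]
  exact ENNReal.ofReal_le_ofReal (by linarith)

theorem measure_preimage_le_of_measurePreserving {α β : Type*} [MeasurableSpace α]
    [MeasurableSpace β] {μ : Measure α} {ν : Measure β} {f : α → β}
    (hf : MeasurePreserving f μ ν) (s : Set β) : μ (f ⁻¹' s) ≤ ν s := by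
  rw [← hf.map_eq]
  exact Measure.le_map_apply hf.measurable.aemeasurable s

theorem measure_iUnion_le_ofReal {Ω ι : Type*} [MeasurableSpace Ω] {μ : Measure Ω} [Fintype ι]
    {B : ι → Set Ω} {a b : ℝ} (hB : ∀ i, μ (B i) ≤ ENNReal.ofReal a)
    (hab : Fintype.card ι * a ≤ b) : μ (⋃ i, B i) ≤ ENNReal.ofReal b := by
  calc μ (⋃ i, B i) ≤ ∑ i, μ (B i) := measure_iUnion_fintype_le μ B
    _ ≤ ∑ _i : ι, ENNReal.ofReal a := Finset.sum_le_sum fun i _ => hB i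
    _ = ENNReal.ofReal (Fintype.card ι * a) := by
        rw [Finset.sum_const, Finset.card_univ, nsmul_eq_mul,
          ENNReal.ofReal_mul (Nat.cast_nonneg _), ENNReal.ofReal_natCast]
    _ ≤ ENNReal.ofReal b := ENNReal.ofReal_le_ofReal hab

end Probability

/-! ### The samples of a run -/

section Samples

variable {X A : Type*} [MeasurableSpace X] [MeasurableSpace A] {d H n : ℕ}

instance (M : DetMDP X A) (π : Policy X A) (h : ℕ) : IsProbabilityMeasure (M.rolloutLaw π h) := by
  unfold DetMDP.rolloutLaw
  infer_instance

instance (M : DetMDP X A) (s : StartScheme) (Q : Finset (Policy X A)) (n : ℕ) :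
    IsProbabilityMeasure (M.startLaw s Q n) := by
  cases s with
  | fresh => unfold DetMDP.startLaw; infer_instance
  | common =>
    exact Measure.isProbabilityMeasure_map
      (measurable_pi_iff.mpr fun p => measurable_pi_apply p.2).aemeasurable

theorem DetMDP.map_fst_rolloutLaw (M : DetMDP X A) (π : Policy X A) (h : ℕ) :
    (M.rolloutLaw π h).map Prod.fst = M.init :=
  Measure.fst_compProd _ _

/-- Rewards in `[0, 1]` are sub-Gaussian with variance proxy `1/4`, given the state. -/
theorem FeatureAssumption.lintegral_rollout_noise_le {M : DetMDP X A} {φ : ℕ → X → A → Feat d}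
    (hfeat : FeatureAssumption M H φ) {h : ℕ} (hh : h < H) {w : Feat d}
    (hw : ∀ x a, M.meanReward h x a = ⟪w, φ h x a⟫) (π : Policy X A) (u : Feat d) :
    ∫⁻ z, ENNReal.ofReal (Real.exp (2 * ⟪M.feature φ π h z.1, u⟫ *
      (z.2 - ⟪w, M.feature φ π h z.1⟫) - ⟪M.feature φ π h z.1, u⟫ ^ 2 / 2))
        ∂M.rolloutLaw π h ≤ 1 := by
  have hfm : Measurable fun z : X × ℝ => M.feature φ π h z.1 :=
    (hfeat.measurable_feature π hh).comp measurable_fst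
  have h2 : Measurable fun z : X × ℝ => ⟪M.feature φ π h z.1, u⟫ := hfm.inner measurable_const
  have h3 : Measurable fun z : X × ℝ => ⟪w, M.feature φ π h z.1⟫ := measurable_const.inner hfm
  rw [DetMDP.rolloutLaw, Measure.lintegral_compProd (by fun_prop)]
  calc _ ≤ ∫⁻ _x, 1 ∂M.init := by
        refine lintegral_mono fun x => ?_
        have := lintegral_exp_mul_sub_mean_le_one
          (M.reward h (M.state π x h, M.action π x h)) measurable_id (a := 0) (b := 1)
          (M.reward_mem h _ _) (2 * ⟪M.feature φ π h x, u⟫)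
        refine le_trans (le_of_eq ?_) this
        rw [Kernel.comap_apply]
        refine lintegral_congr fun r => ?_
        have hmean : ∫ r, id r ∂(M.reward h (M.state π x h, M.action π x h)) =
          ⟪w, M.feature φ π h x⟫ := hw _ _
        rw [hmean]
        congr 2
        simp only [id]
        ring
    _ = 1 := by simp

end Samples

/-! ### The constants of the bound -/

section Constants

theorem zeta_nonneg (d H n : ℕ) (lam δ : ℝ) : 0 ≤ zeta d H n lam δ :=
  add_nonneg (Real.sqrt_nonneg _) (Real.sqrt_nonneg _)

theorem boundC_eq (d H n : ℕ) {lam : ℝ} (hlam : 0 < lam) (δ : ℝ) :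
    boundC d H n lam δ = 2 * (√(d : ℝ) +
      √(2 * Real.log (H / δ) + d * Real.log (1 + n / lam)) / 2 / √lam) := by
  have h := Real.sqrt_pos.mpr hlam
  rw [boundC, zeta, Real.sqrt_mul hlam.le]
  field_simp
  ring

theorem sqrt_le_boundC (d H n : ℕ) (lam δ : ℝ) : √(d : ℝ) ≤ boundC d H n lam δ :=
  le_add_of_nonneg_right (mul_nonneg (inv_nonneg.mpr (Real.sqrt_nonneg _)) (zeta_nonneg _ _ _ _ _))

/-- The deviation allowed by `epsStat` dominates the one that holds by concentration. -/
theorem deviation_sq_le {d H n : ℕ} (hn : 1 ≤ n) (hd : 1 ≤ d) (hH : 1 ≤ H) (lam : ℝ) {δ : ℝ}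
    (hδ : 0 < δ) (hδ1 : δ < 1) :
    2 * (2 * Real.log (1 / (δ / (H * d))) + d * Real.log 2) / n ≤
      √(8 * (d * Real.log (1 + 2 * n * boundC d H n lam δ) + Real.log (2 * H * d / δ)) / n) ^ 2 := by
  have hn' : (1 : ℝ) ≤ n := by exact_mod_cast hn
  have hd' : (1 : ℝ) ≤ d := by exact_mod_cast hd
  have hH' : (1 : ℝ) ≤ H := by exact_mod_cast hH
  have hC : 1 ≤ boundC d H n lam δ := (Real.one_le_sqrt.mpr hd').trans (sqrt_le_boundC d H n lam δ)
  have hnC : 1 ≤ n * boundC d H n lam δ := one_le_mul_of_one_le_of_one_le hn' hC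
  have hHd : 1 ≤ (H : ℝ) * d := one_le_mul_of_one_le_of_one_le hH' hd'
  have hlog2 : 0 ≤ Real.log 2 := Real.log_nonneg one_le_two
  have h1 : Real.log 2 ≤ Real.log (1 + 2 * n * boundC d H n lam δ) :=
    Real.log_le_log two_pos (by nlinarith)
  have h2 : 1 / (δ / (H * d)) = H * d / δ := one_div_div _ _
  have h3 : 0 ≤ Real.log (H * d / δ) :=
    Real.log_nonneg (by rw [le_div_iff₀ hδ]; linarith)
  have h4 : Real.log (H * d / δ) ≤ Real.log (2 * H * d / δ) := by
    refine Real.log_le_log (by positivity) ?_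
    rw [mul_assoc]
    exact div_le_div_of_nonneg_right (by linarith) hδ.le
  have h5 : (d : ℝ) * Real.log 2 ≤ d * Real.log (1 + 2 * n * boundC d H n lam δ) :=
    mul_le_mul_of_nonneg_left h1 (by linarith)
  have h6 : 0 ≤ (d : ℝ) * Real.log 2 := mul_nonneg (by linarith) hlog2
  rw [Real.sq_sqrt (div_nonneg (by linarith) (by linarith)), h2]
  exact div_le_div_of_nonneg_right (by linarith) (by linarith)

end Constants

end LinBC

open LinBC
theorem mainTheorem7 {X A : Type*} [MeasurableSpace X] [MeasurableSpace A] {d : ℕ} (H n : ℕ)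
    (hn : 1 ≤ n) (M : DetMDP X A) (φ : ℕ → X → A → Feat d) (o : ArgmaxOracle H φ)
    (Ψ Γ : ℕ → Finset (Policy X A)) (S : ℕ → Submodule ℝ (Feat d)) (s : StartScheme)
    (lam δ εspan εconc : ℝ) (hlam : 0 < lam) (hδ : 0 < δ) (hδ1 : δ < 1)
    (hspan_pos : 0 < εspan) (hconc_nonneg : 0 ≤ εconc)
    (hfeat : FeatureAssumption M H φ) (hlbc : LinearBellmanComplete M H φ)
    (hcover : ∀ ℓ < H, ProbAtLeast (M.startLaw s (Ψ ℓ) n) (1 - δ / (H : ℝ) ^ 2)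
      {x | S ℓ ≤ Submodule.span ℝ
        (range fun p : Ψ ℓ × Fin n => M.feature φ (p.1 : Policy X A) ℓ (x p))})
    (hspan : ∀ ℓ < H, ∀ ρ : Policy X A, ∃ β : Policy X A → ℝ,
      (∀ π ∈ Γ ℓ, β π ∈ Icc (-2 : ℝ) 2) ∧
        ‖M.meanFeature φ ρ ℓ - ∑ π ∈ Γ ℓ, β π • M.meanFeature φ π ℓ‖ ≤ εspan)
    (hcard : ∀ ℓ < H, (Ψ ℓ).card ≤ d ∧ (Γ ℓ).card ≤ d)
    (hconc : ProbAtLeast M.init (1 - εconc) (coveredStates M H φ S)) :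
    ProbAtLeast (M.sampleLaw s H Ψ Γ n) (1 - 3 * δ)
      {ω | ∀ π : Policy X A,
        ∫ x, (M.value H π x - M.value H (policyOpt M H φ o lam ω) x) ∂M.init ≤
          ∑ _ℓ ∈ Finset.range H,
            (2 * √((d : ℝ) / n) * zeta d H n lam δ + 2 * d * epsStat d H n lam δ +
              (√(d : ℝ) + boundC d H n lam δ) * εspan) +
          H * boundC d H n lam δ * εconc} := by
  choose! wstar hwnorm hwlin using hfeat.reward_linear
  set C := boundC d H n lam δ with hC
  set κ := √(2 * Real.log (H / δ) + d * Real.log (1 + n / lam)) with hκ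
  set η := √(8 * (d * Real.log (1 + 2 * n * C) + Real.log (2 * H * d / δ)) / n) with hη
  have hκ0 : 0 ≤ κ := Real.sqrt_nonneg _
  have hη0 : 0 ≤ η := Real.sqrt_nonneg _
  have hC0 : 0 ≤ C := (Real.sqrt_nonneg _).trans (sqrt_le_boundC d H n lam δ)
  have hC2 : √(d : ℝ) + κ / 2 / √lam = C / 2 := by
    rw [hC, boundC_eq d H n hlam, ← hκ]; ring
  have hζ2 : √lam * √(d : ℝ) / 2 + κ / 2 = zeta d H n lam δ / 2 := by
    rw [zeta, Real.sqrt_mul hlam.le, ← hκ]; ring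
  let I := (ℓ : Fin H) × (Γ ℓ × Fin n)
  let feat : (ℓ : Fin H) → (I → X × ℝ) → Γ ℓ × Fin n → Feat d := fun ℓ ω p =>
    M.feature φ (p.1 : Policy X A) ℓ (ω ⟨ℓ, p⟩).1
  let noise : (ℓ : Fin H) → (I → X × ℝ) → Feat d := fun ℓ ω =>
    ∑ p, ((ω ⟨ℓ, p⟩).2 - ⟪wstar ℓ, feat ℓ ω p⟫) • feat ℓ ω p
  -- the bad events: large regression noise, large deviation of an average feature, and failure of
  -- the planning data to span
  let badNoise : Fin H → Set (I → X × ℝ) := fun ℓ => {ω | ¬ ∀ y : Feat d,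
    lam • y + (gram (feat ℓ ω)).toEuclideanLin y = noise ℓ ω → ⟪y, noise ℓ ω⟫ ≤ (κ / 2) ^ 2}
  let badDev : ((ℓ : Fin H) × Γ ℓ) → Set (I → X × ℝ) := fun q => {ω |
    ¬ ‖(n : ℝ)⁻¹ • ∑ m, feat q.1 ω (q.2, m) - M.meanFeature φ q.2 q.1‖ ≤ η}
  let badData : (ℓ : Fin H) → Set (Starts X (Ψ ℓ) n) := fun ℓ => {x | S ℓ ≤ Submodule.span ℝ
    (range fun p : Ψ ℓ × Fin n => M.feature φ (p.1 : Policy X A) ℓ (x p))}ᶜ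
  set Pr := Measure.pi fun i : I => M.rolloutLaw i.2.1 i.1 with hPr
  set Ps := Measure.pi fun ℓ : Fin H => M.startLaw s (Ψ ℓ) n with hPs
  have hlaw : M.sampleLaw s H Ψ Γ n = Pr.prod Ps := rfl
  have hH : ∀ ℓ : Fin H, (1 : ℝ) ≤ H := fun ℓ => by
    exact_mod_cast Nat.one_le_iff_ne_zero.mpr (Nat.ne_of_gt (ℓ.pos))
  have hinj : ∀ ℓ : Fin H, Function.Injective fun p : Γ ℓ × Fin n => (⟨ℓ, p⟩ : I) :=
    fun ℓ => sigma_mk_injective (β := fun ℓ : Fin H => Γ ℓ × Fin n) (i := ℓ)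
  have h_noise : ∀ ℓ, Pr (badNoise ℓ) ≤ ENNReal.ofReal (δ / H) := by
    intro ℓ
    have hH0 : (0 : ℝ) < H := by linarith [hH ℓ]
    have h := measure_regression_noise_le (fun i : I => M.rolloutLaw i.2.1 i.1)
      (fun p : Γ ℓ × Fin n => (⟨ℓ, p⟩ : I)) (hinj ℓ)
      (fun p => M.feature φ (p.1 : Policy X A) ℓ)
      (fun p => hfeat.measurable_feature _ ℓ.2) (fun p => hfeat.norm_feature_le _ ℓ.2)
      (wstar ℓ) (fun p u => hfeat.lintegral_rollout_noise_le ℓ.2 (hwlin ℓ ℓ.2) _ u)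
      hlam (div_pos hδ hH0) ((div_le_one hH0).mpr (hδ1.le.trans (hH ℓ))) (N := n)
      (Nat.cast_nonneg n) (by
        rw [Fintype.card_prod, Fintype.card_coe, Fintype.card_fin]
        exact_mod_cast Nat.mul_le_mul_right n (hcard ℓ ℓ.2).2)
    rw [one_div_div] at h
    exact h
  have h_dev : ∀ q, Pr (badDev q) ≤ ENNReal.ofReal (δ / (H * d)) := by
    rintro ⟨ℓ, π⟩
    -- the failure probability is meaningful since `Γ ℓ` is nonempty, so that `d` is not zero
    have hΓ : 0 < (Γ ℓ).card := Finset.card_pos.mpr ⟨π, π.2⟩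
    have hd : 1 ≤ d := (Nat.succ_le_of_lt hΓ).trans (hcard ℓ ℓ.2).2
    have hd0 : (0 : ℝ) < d := by exact_mod_cast hd
    have hH0 : (0 : ℝ) < H := by linarith [hH ℓ]
    exact measure_average_deviation_le hn (fun i : I => M.rolloutLaw i.2.1 i.1)
      (fun m => (⟨ℓ, (π, m)⟩ : I)) ((hinj ℓ).comp (Prod.mk_right_injective π)) M.init
      (fun m => M.map_fst_rolloutLaw _ _) (M.feature φ (π : Policy X A) ℓ)
      (hfeat.measurable_feature _ ℓ.2) (hfeat.norm_feature_le _ ℓ.2)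
      (div_pos hδ (mul_pos hH0 hd0)) hη0
      (deviation_sq_le hn hd (Nat.one_le_iff_ne_zero.mpr (Nat.ne_of_gt ℓ.pos)) lam hδ hδ1)
  have h_data : ∀ ℓ, Ps ((fun x => x ℓ) ⁻¹' badData ℓ) ≤ ENNReal.ofReal (δ / (H : ℝ) ^ 2) := fun ℓ =>
    (measure_preimage_le_of_measurePreserving
      (measurePreserving_eval (fun ℓ : Fin H => M.startLaw s (Ψ ℓ) n) ℓ) (badData ℓ)).trans
        (hcover ℓ ℓ.2).measure_compl_le
  have h_noise_union : Pr (⋃ ℓ, badNoise ℓ) ≤ ENNReal.ofReal δ := by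
    refine measure_iUnion_le_ofReal h_noise ?_
    rw [Fintype.card_fin]
    rw [← mul_div_assoc]
    exact div_le_of_le_mul₀ (Nat.cast_nonneg H) hδ.le (mul_comm _ _).le
  have h_dev_union : Pr (⋃ q, badDev q) ≤ ENNReal.ofReal δ := by
    refine measure_iUnion_le_ofReal h_dev ?_
    have hc : (Fintype.card ((ℓ : Fin H) × Γ ℓ) : ℝ) ≤ H * d := by
      rw [Fintype.card_sigma]
      simp only [Fintype.card_coe]
      have := Finset.sum_le_card_nsmul Finset.univ (fun ℓ : Fin H => (Γ ℓ).card) d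
        fun ℓ _ => (hcard ℓ ℓ.2).2
      rw [Finset.card_univ, Fintype.card_fin, smul_eq_mul] at this
      exact_mod_cast this
    rw [← mul_div_assoc]
    refine div_le_of_le_mul₀ (by positivity) hδ.le ?_
    rw [mul_comm]
    exact mul_le_mul_of_nonneg_left hc hδ.le
  have h_data_union : Ps (⋃ ℓ, (fun x => x ℓ) ⁻¹' badData ℓ) ≤ ENNReal.ofReal δ := by
    refine measure_iUnion_le_ofReal h_data ?_
    rw [Fintype.card_fin, ← mul_div_assoc]
    refine div_le_of_le_mul₀ (by positivity) hδ.le ?_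
    rw [mul_comm]
    exact mul_le_mul_of_nonneg_left (by exact_mod_cast Nat.le_self_pow two_ne_zero H) hδ.le
  rw [hlaw]
  refine probAtLeast_of_measure_compl_le (by positivity) ?_
  have hbad : (Pr.prod Ps) (Prod.fst ⁻¹' (⋃ ℓ, badNoise ℓ) ∪ Prod.fst ⁻¹' (⋃ q, badDev q) ∪
      Prod.snd ⁻¹' (⋃ ℓ, (fun x => x ℓ) ⁻¹' badData ℓ)) ≤ ENNReal.ofReal (3 * δ) := by
    have hfst : MeasurePreserving Prod.fst (Pr.prod Ps) Pr := measurePreserving_fst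
    have hsnd : MeasurePreserving Prod.snd (Pr.prod Ps) Ps := measurePreserving_snd
    refine (measure_union_le _ _).trans ((add_le_add ((measure_union_le _ _).trans (add_le_add
      ((measure_preimage_le_of_measurePreserving hfst _).trans h_noise_union)
        ((measure_preimage_le_of_measurePreserving hfst _).trans h_dev_union)))
        ((measure_preimage_le_of_measurePreserving hsnd _).trans h_data_union)).trans (le_of_eq ?_))
    rw [← ENNReal.ofReal_add hδ.le hδ.le, ← ENNReal.ofReal_add (by positivity) hδ.le]
    congr 1; ring
  refine (measure_mono (compl_subset_comm.mp fun ω hω => ?_)).trans hbad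
  simp only [mem_compl_iff, mem_union, mem_preimage, mem_iUnion, not_or, not_exists] at hω
  obtain ⟨⟨hgNoise, hgDev⟩, hgData⟩ := hω
  intro π
  have hridge : ∀ h < H, ‖rewardParam M H φ lam ω h‖ ≤ C / 2 ∧
      ‖wstar h - rewardParam M H φ lam ω h‖ ≤ C / 2 ∧
      ∑ ρ ∈ Γ h, |⟪wstar h - rewardParam M H φ lam ω h, M.meanFeature φ ρ h⟫| ≤
        √((d : ℝ) / n) * (zeta d H n lam δ / 2) + d * (C / 2 * η) := by
    intro h hh
    have hr : rewardParam M H φ lam ω h =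
        ridge lam (feat ⟨h, hh⟩ ω.1) fun p => (ω.1 ⟨⟨h, hh⟩, p⟩).2 := by
      rw [rewardParam, dif_pos hh]
    obtain ⟨h1, h2, h3⟩ := ridge_error_bounds hlam (feat ⟨h, hh⟩ ω.1)
      (fun p => (ω.1 ⟨⟨h, hh⟩, p⟩).2) (wstar h) (hwnorm h hh) (K := κ / 2) (by positivity)
      (not_not.mp (hgNoise ⟨h, hh⟩))
    rw [← hr, hC2] at h1 h2
    rw [← hr, hζ2] at h3
    exact ⟨h1, h2, sum_abs_inner_le_of_average (Γ h) hn (feat ⟨h, hh⟩ ω.1) _ _ hη0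
      (hcard h hh).2 h2 h3 fun ρ => not_not.mp (hgDev ⟨⟨h, hh⟩, ρ⟩)⟩
  have hmain := integral_value_sub_greedy_le hlbc hfeat o (s := ω.2) (by positivity : 0 ≤ C / 2)
    hwlin (fun h hh => (hridge h hh).1) (fun h hh => (hridge h hh).2.1)
    (fun h hh => (hridge h hh).2.2) hspan hconc (fun ℓ => not_not.mp (hgData ℓ)) π
  refine hmain.trans (add_le_add (Finset.sum_le_sum fun _ _ => ?_) (le_of_eq (by ring)))
  have hstat : epsStat d H n lam δ = C * η + 2 / n := rfl
  rw [hstat]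
  -- the slack that remains: the term `2 / n` of `epsStat`, and `√d εspan`
  have e1 : 0 ≤ (d : ℝ) * (2 / n) := by positivity
  have e2 : 0 ≤ √(d : ℝ) * εspan := by positivity
  linarith
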